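/- Let $q$ be a prime power, let $S$ be a set of points in $\mathrm{PG}(2,q)$, and let $\ell$ be a $k$-secant of $S$ (a line meeting $S$ in exactly $k$ points) with $2\le k\le q$. Let $1\le t\le q-3$ be an integer, and suppose that through each point $P$ of $\ell\cap S$ there pass exactly $t$ tangents to $S$ (lines meeting $S$ only in $P$). Define $\varepsilon$ by $|S|=k+q-t+\varepsilon$. A line is skew if it contains no point of $S$; let $A(n)$ be the set of points of $\ell\setminus S$ through which there pass at most $n$ skew lines. A pencil is the set of all lines through a point, its carrier; a set of lines belongs to $m$ pencils if there are $m$ distinct points such that each line of the set passes through at least one of them. A dual arc is a set of lines no three of which are concurrent, and a dual $k$-arc is a dual arc of $k$ lines. Then the following hold. If $t=1$: 1. If $\varepsilon<\frac{k}{2}-1$, then the $k$ tangents at the points of $\ell\cap S$ and the skew lines through the points of $A(2)$ all belong to one pencil, and $A(2)\setminus A(1)=\emptyset$. 2. If $\varepsilon<\frac{2k}{3}-2$, then the $k$ tangents at the points of $\ell\cap S$ either belong to two pencils or form a dual $k$-arc. If moreover $k<q$, then the skew lines through the points of $A(2)$ belong to the same two pencils in the first case, and together with the $k$ tangents form a dual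 arc in the second case. If $t\ge 2$ and $k>q-\frac{q}{t}+1$: 3. If $\varepsilon<\frac{k}{t+1}-\frac{t}{2}$, then the $kt$ tangents at the points of $\ell\cap S$ and the skew lines through the points of $A(t+1)$ belong to $t$ pencils whose carriers are not on $\ell$, and $A(t+1)\setminus A(t)=\emptyset$. 4. If $\varepsilon<\frac{k}{t+1}-1$ and $t\le\sqrt{q}$, then the $kt$ tangents at the points of $\ell\cap S$ belong to $t+1$ pencils whose carriers are not on $\ell$. If moreover $k<q$, then the skew lines through the points of $A(t+1)$ belong to the same $t+1$ pencils. -/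

import Mathlib

open scoped LinearAlgebra.Projectivization

namespace PG2

/-- The points `(x : y : z)` of `PG(2, q)`, where `F = GF(q)`. -/
abbrev Point (F : Type*) [Field F] := ℙ F (Fin 3 → F)

/-- The lines `[a : b : c]` of `PG(2, q)`. A point `P : Point F` and a line `r : Line F` are
incident, `P ∈ r`, iff `a x + b y + c z = 0`
(this is Mathlib's instance, see `Configuration.ofField.mem_iff`). -/
abbrev Line (F : Type*) [Field F] := ℙ F (Fin 3 → F)

variable {F : Type*} [Field F]

/-- The set of points of `S` on the line `r`. -/
def meet (S : Set (Point F)) (r : Line F) : Set (Point F) := {P : Point F | P ∈ S ∧ P ∈ r}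

/-- `r` is a `k`-secant of `S`: it meets `S` in exactly `k` points. -/
def IsSecant (S : Set (Point F)) (k : ℕ) (r : Line F) : Prop := (meet S r).ncard = k

/-- `r` is skew to `S`: it contains no point of `S`. -/
def IsSkew (S : Set (Point F)) (r : Line F) : Prop := meet S r = ∅

/-- The tangents to `S` at `P`: the lines meeting `S` in the point `P` only. -/
def tangentsAt (S : Set (Point F)) (P : Point F) : Set (Line F) := {r : Line F | meet S r = {P}}

/-- The lines skew to `S` that pass through the point `Q`. -/
def skewLinesThrough (S : Set (Point F)) (Q : Point F) : Set (Line F) :=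
  {r : Line F | Q ∈ r ∧ IsSkew S r}

/-- The set `A(n)` of the points of `ℓ \ S` through which there pass at most `n` skew lines. -/
def A (S : Set (Point F)) (ℓ : Line F) (n : ℕ) : Set (Point F) :=
  {Q : Point F | Q ∈ ℓ ∧ Q ∉ S ∧ (skewLinesThrough S Q).ncard ≤ n}

/-- The tangents to `S` at the points of `ℓ ∩ S`. -/
def tangentsAlong (S : Set (Point F)) (ℓ : Line F) : Set (Line F) :=
  {r : Line F | ∃ P ∈ meet S ℓ, r ∈ tangentsAt S P}

/-- The skew lines to `S` through the points of `A(n)`. -/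
def skewLinesAlong (S : Set (Point F)) (ℓ : Line F) (n : ℕ) : Set (Line F) :=
  {r : Line F | ∃ Q ∈ A S ℓ n, r ∈ skewLinesThrough S Q}

/-- The pencil with carrier `G`: all the lines through `G`. -/
def pencil (G : Point F) : Set (Line F) := {r : Line F | G ∈ r}

/-- Every line of `L` belongs to one of the pencils whose carriers are the points of `C`. -/
def BelongToPencils (L : Set (Line F)) (C : Finset (Point F)) : Prop :=
  ∀ r ∈ L, ∃ G ∈ C, r ∈ pencil G

/-- `L` is a dual arc: no three lines of `L` are concurrent. -/
def IsDualArc (L : Set (Line F)) : Prop := ∀ G : Point F, (L ∩ pencil G).ncard ≤ 2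

/-- `L` is a dual `k`-arc: a set of `k` lines, no three of which are concurrent. -/
def IsDualKArc (k : ℕ) (L : Set (Line F)) : Prop := L.ncard = k ∧ IsDualArc L

end PG2

/-! Take $\ell$ as the line at infinity with its vertical point outside $S$, and let $U$ be the
affine part of $S$, so $|U| = q - t + \varepsilon$. The Rédei polynomial $R(X,Y) = \prod_{(a,b)\in
U} (X - aY + b)$ is nonzero at $(x,y)$ exactly when the affine line with parameters $(x,y)$ misses
$U$; such a line is a tangent or a skew line according to whether its direction is in $S$. It has to
be shown that these lines lie on a dual curve $Q = 0$ of class $t$ (or 2).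

The moments $c_i(Y) = \sum_x x^i R(x,Y)$ have low degree, since power sums over $F$ mostly vanish.
At $y$ they are the moments of a weight supported on the missing lines of slope $y$. For the $k$
slopes of $\ell \cap S$ this support has $t$ elements, so the $m$-th Hankel determinant is divisible
by $(Y-y)^{m-t}$ for each of them, and for a range of $m > t$ its degree is too small for that
unless it is zero (`VanishAt.det_eq_zero`). Hence some primitive $Q$ is orthogonal to many powers of
$X$ (`exists_orthogonal`). Orthogonality makes $Q$ vanish on every small missing set
(`eval_eq_zero_of_sum_eq_zero`), and a recursion between twisted Hankel determinants bounds its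
total degree (`totLE_of_orthogonal`).

If $k > q - q/t + 1$, pigeonhole finds a linear factor of $Q$, and repeating this splits $Q$ into
$t$ pencils (`exists_carriers`). For $t = 1$ this condition always holds, which gives the first
claim. For the second claim $Q$ has class at most 2: either no three of its lines concur, or the
quadratic form splits into two pencils (`isDualArc_or_belongToPencils`). For $t \ge 2$ both bounds
on $\varepsilon$ yield $t$ pencils. -/

namespace MomentFunctional

open Polynomial

/-! ### Hankel determinants of a moment functional. -/

section CommRing

variable {R : Type*} [CommRing R]

/-- The linear functional on `R[X]` whose `i`-th moment, the value at `X ^ i`, is `c i`. -/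
noncomputable def moment (c : ℕ → R) : R[X] →ₗ[R] R :=
  Polynomial.lsum fun i => LinearMap.toSpanSingleton R R (c i)

theorem moment_apply (c : ℕ → R) (f : R[X]) : moment c f = f.sum fun i a => a * c i := by
  simp [moment, lsum_apply]

theorem moment_C_mul (c : ℕ → R) (a : R) (f : R[X]) : moment c (C a * f) = a * moment c f := by
  rw [← smul_eq_C_mul, map_smul, smul_eq_mul]

theorem moment_X_pow (c : ℕ → R) (i : ℕ) : moment c (X ^ i) = c i := by
  rw [moment_apply, ← monomial_one_right_eq_X_pow, sum_monomial_index] <;> simp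

/-- The Hankel matrix of the moments of `c` twisted by `g`. -/
noncomputable def hankel (c : ℕ → R) (g : R[X]) (n : ℕ) : Matrix (Fin n) (Fin n) R :=
  Matrix.of fun i j => moment c (g * X ^ (i : ℕ) * X ^ (j : ℕ))

theorem sum_fin_C_mul_X_pow {n : ℕ} {f : R[X]} (hf : f.degree < n) :
    ∑ i : Fin n, C (f.coeff i) * X ^ (i : ℕ) = f := by
  ext k
  rw [finsetSum_coeff]
  simp only [coeff_C_mul, coeff_X_pow, mul_ite, mul_one, mul_zero]
  by_cases hk : k < n
  · rw [Finset.sum_eq_single (⟨k, hk⟩ : Fin n)]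
    · simp
    · intro b _ hb
      rw [if_neg]
      rintro rfl
      exact hb rfl
    · simp
  · rw [Finset.sum_eq_zero, coeff_eq_zero_of_degree_lt]
    · exact hf.trans_le (by exact_mod_cast not_lt.mp hk)
    · intro i _
      rw [if_neg]
      have := i.2
      omega

theorem moment_eq_zero_of_degree_lt {c : ℕ → R} {g f : R[X]} {m : ℕ} (hf : f.degree < m)
    (h : ∀ i < m, moment c (g * X ^ i) = 0) : moment c (g * f) = 0 := by
  rw [← sum_fin_C_mul_X_pow hf, Finset.mul_sum, map_sum]
  refine Finset.sum_eq_zero fun i _ => ?_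
  rw [mul_left_comm, moment_C_mul, h i i.2, mul_zero]

/-- The two determinant arguments below are row changes carried out through this factorization. -/
theorem gram_eq_mul_hankel (c : ℕ → R) (g : R[X]) {n : ℕ} (r : Fin n → R[X])
    (hr : ∀ j, (r j).degree < n) :
    (Matrix.of fun j l : Fin n => moment c (g * r j * X ^ (l : ℕ))) =
      (Matrix.of fun j m : Fin n => (r j).coeff m) * hankel c g n := by
  ext j l
  rw [Matrix.mul_apply]
  simp only [Matrix.of_apply, hankel]
  conv_lhs => rw [← sum_fin_C_mul_X_pow (hr j), Finset.mul_sum, Finset.sum_mul, map_sum]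
  refine Finset.sum_congr rfl fun i _ => ?_
  rw [← moment_C_mul]
  congr 1
  ring

theorem hankel_mulVec {c : ℕ → R} {n : ℕ} {f : R[X]} (hf : f.degree < n) (i : Fin n) :
    (hankel c 1 n).mulVec (fun j => f.coeff j) i = moment c (f * X ^ (i : ℕ)) := by
  conv_rhs => rw [← sum_fin_C_mul_X_pow hf, Finset.sum_mul, map_sum]
  simp only [Matrix.mulVec, dotProduct, hankel, Matrix.of_apply]
  refine Finset.sum_congr rfl fun j _ => ?_
  rw [mul_assoc (C _), moment_C_mul, mul_comm, one_mul, mul_comm (X ^ _)]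

/-- A polynomial `b` all of whose multiples have moments divisible by `π` makes the Hankel
determinants divisible by powers of `π`. -/
theorem pow_dvd_det_hankel {c : ℕ → R} {π : R} {b : R[X]} (hb : b.Monic)
    (hπ : ∀ g, π ∣ moment c (b * g)) (g : R[X]) (m : ℕ) :
    π ^ (m - b.natDegree) ∣ (hankel c g m).det := by
  nontriviality R
  set r := b.natDegree with hr
  -- Monic polynomials of degrees $0, \dots, m-1$ give a unimodular change of rows. The rows of
  -- index at least `r` come from multiples of `b`, and each contributes a factor `π`.
  let p : Fin m → R[X] := fun j => if (j : ℕ) < r then X ^ (j : ℕ) else b * X ^ ((j : ℕ) - r)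
  have hp : ∀ j, (p j).Monic ∧ (p j).natDegree = j := by
    intro j
    by_cases hj : (j : ℕ) < r
    · simp [p, hj, monic_X_pow]
    · simp only [p, hj, if_false]
      refine ⟨hb.mul (monic_X_pow _), ?_⟩
      rw [hb.natDegree_mul (monic_X_pow _), natDegree_X_pow]
      omega
  have hdeg : ∀ j, (p j).degree < m := fun j => by
    rw [degree_eq_natDegree (hp j).1.ne_zero, (hp j).2]
    exact_mod_cast j.2
  have h1 := congrArg Matrix.det (gram_eq_mul_hankel c g p hdeg)
  have h2 : (Matrix.of fun j m : Fin m => (p j).coeff m).det = 1 := by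
    rw [← Matrix.det_transpose]
    exact Matrix.det_matrixOfPolynomials p (fun j => (hp j).2) (fun j => (hp j).1)
  rw [Matrix.det_mul, h2, one_mul] at h1
  rw [← h1]
  have hd : ∀ j l : Fin m, (if (j : ℕ) < r then 1 else π) ∣
      moment c (g * p j * X ^ (l : ℕ)) := by
    intro j l
    by_cases hj : (j : ℕ) < r
    · simp [hj]
    · simp only [p, hj, if_false]
      rw [show g * (b * X ^ ((j : ℕ) - r)) * X ^ (l : ℕ) =
        b * (g * X ^ ((j : ℕ) - r) * X ^ (l : ℕ)) by ring]
      exact hπ _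
  have hprod : ∏ j : Fin m, (if (j : ℕ) < r then (1 : R) else π) = π ^ (m - r) := by
    rw [Finset.prod_ite, Finset.prod_const_one, one_mul, Finset.prod_const]
    congr 1
    have h3 := Fin.card_filter_val_lt (n := m) (m := r)
    have h4 := Finset.card_filter_add_card_filter_not
      (s := (Finset.univ : Finset (Fin m))) (fun j => (j : ℕ) < r)
    rw [h3, Finset.card_univ, Fintype.card_fin] at h4
    omega
  rw [← hprod, Matrix.det_apply']
  refine Finset.dvd_sum fun σ _ => Dvd.dvd.mul_left ?_ _
  rw [← Equiv.prod_comp σ]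
  exact Finset.prod_dvd_prod_of_dvd _ _ fun j _ => hd (σ j) j

/-- The recursion between the Hankel determinants twisted by the powers of `X - a`, when `Q` is
orthogonal to the small powers of `X`. -/
theorem coeff_mul_det_hankel_succ {c : ℕ → R} {Q : R[X]} {n M : ℕ} (hn : n ≠ 0)
    (hQ : Q.natDegree ≤ n) (hM : ∀ j < M, moment c (Q * X ^ j) = 0) (a : R) {i : ℕ}
    (hi : i + n ≤ M) :
    Q.coeff n * (hankel c ((X - C a) ^ (i + 1)) n).det =
      (-1) ^ n * Q.eval a * (hankel c ((X - C a) ^ i) n).det := by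
  nontriviality R
  obtain ⟨k, rfl⟩ := Nat.exists_eq_succ_of_ne_zero hn
  set g := (X - C a) ^ i with hg
  -- The natural choice $(X-a)X^j$ has too large a degree for $j = k$; subtracting `Q` cancels the
  -- leading term and, by orthogonality, does not change the moments.
  set r : Fin (k + 1) → R[X] := fun j =>
    if (j : ℕ) < k then (X - C a) * X ^ (j : ℕ) else C (Q.coeff (k + 1)) * ((X - C a) * X ^ k) - Q
    with hr
  have hcoeff : ∀ j m : ℕ, ((X - C a) * X ^ j : R[X]).coeff m =
      (if m = j + 1 then 1 else 0) - a * (if m = j then 1 else 0) := by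
    intro j m
    rw [sub_mul, ← pow_succ', coeff_sub, coeff_C_mul, coeff_X_pow, coeff_X_pow]
  have hdeg : ∀ j, (r j).degree < (k + 1 : ℕ) := by
    intro j
    rw [degree_lt_iff_coeff_zero]
    intro m hm
    simp only [hr]
    split_ifs with hj
    · rw [hcoeff, if_neg (by omega), if_neg (by omega)]
      simp
    · rw [coeff_sub, coeff_C_mul, hcoeff]
      rcases hm.eq_or_lt with rfl | hm
      · simp
      · rw [if_neg (by omega), if_neg (by omega), coeff_eq_zero_of_natDegree_lt
          (lt_of_le_of_lt hQ hm)]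
        simp
  have h1 := gram_eq_mul_hankel c g r hdeg
  have h2 : (Matrix.of fun j l : Fin (k + 1) => moment c (g * r j * X ^ (l : ℕ))) =
      (hankel c ((X - C a) ^ (i + 1)) (k + 1)).updateRow (Fin.last k)
        (Q.coeff (k + 1) • hankel c ((X - C a) ^ (i + 1)) (k + 1) (Fin.last k)) := by
    ext j l
    rw [Matrix.updateRow_apply]
    by_cases hj : (j : ℕ) < k
    · have : j ≠ Fin.last k := fun h => by simp [h] at hj
      simp only [hr, hj, this, if_true, if_false, hankel, Matrix.of_apply, hg, pow_succ]
      congr 1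
      ring
    · have hj' : j = Fin.last k := Fin.ext (by have := j.2; simp; omega)
      subst hj'
      simp only [hr, hankel, Matrix.of_apply, hg, if_true, Fin.val_last, lt_irrefl, if_false,
        Pi.smul_apply, smul_eq_mul]
      rw [← moment_C_mul, ← sub_eq_zero, ← map_sub, ← neg_eq_zero, ← map_neg,
        show -((X - C a) ^ i * (C (Q.coeff (k + 1)) * ((X - C a) * X ^ k) - Q) * X ^ (l : ℕ) -
          C (Q.coeff (k + 1)) * ((X - C a) ^ (i + 1) * X ^ k * X ^ (l : ℕ))) =
          Q * ((X - C a) ^ i * X ^ (l : ℕ)) by ring]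
      refine moment_eq_zero_of_degree_lt (m := M) ?_ hM
      have hmon : ((X - C a) ^ i * X ^ (l : ℕ)).Monic :=
        ((monic_X_sub_C a).pow i).mul (monic_X_pow _)
      rw [← natDegree_lt_iff_degree_lt hmon.ne_zero,
        ((monic_X_sub_C a).pow i).natDegree_mul (monic_X_pow _), natDegree_X_pow,
        (monic_X_sub_C a).natDegree_pow, natDegree_X_sub_C]
      have := l.2
      grind
  have h3 : (Matrix.of fun j m : Fin (k + 1) => (r j).coeff m).det =
      (-1) ^ (k + 1) * Q.eval a := by
    set B := Matrix.of fun j m : Fin (k + 1) => (r j).coeff m with hB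
    -- Adding $a^m$ times column $m$ to column 0 turns it into the values at $a$: zero except for
    -- $-Q(a)$ in the last row. The remaining minor is unitriangular.
    have e1 := Matrix.det_updateCol_sum B 0 fun m => a ^ (m : ℕ)
    rw [Fin.val_zero, pow_zero, one_smul] at e1
    have e2 : (fun j => ∑ m : Fin (k + 1), a ^ (m : ℕ) • B j m) = fun j => (r j).eval a := by
      funext j
      conv_rhs => rw [← sum_fin_C_mul_X_pow (hdeg j), eval_finsetSum]
      refine Finset.sum_congr rfl fun m _ => ?_
      rw [eval_mul, eval_C, eval_pow, eval_X, hB, Matrix.of_apply, smul_eq_mul, mul_comm]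
    have e3 : ((B.updateCol 0 fun j => (r j).eval a).submatrix (Fin.last k).succAbove
        Fin.succ).det = 1 := by
      rw [Matrix.det_of_isLowerTriangular]
      · refine Finset.prod_eq_one fun j _ => ?_
        simp [hB, hr, hcoeff]
      · intro j m hjm
        have : (j : ℕ) < m := hjm
        have h5 : (m : ℕ) ≠ j := by omega
        have h6 : (m : ℕ) + 1 ≠ j := by omega
        simp [hB, hr, hcoeff, h5, h6]
    rw [← e1, e2, Matrix.det_succ_column_zero, Finset.sum_eq_single (Fin.last k), e3]
    · simp [hr, pow_succ]
    · intro j _ hj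
      have : (j : ℕ) < k := Fin.val_lt_last hj
      simp [hr, this]
    · simp
  have h4 := congrArg Matrix.det h1
  rw [h2, Matrix.det_updateRow_smul, Matrix.updateRow_eq_self, Matrix.det_mul, h3] at h4
  exact h4

end CommRing

/-! ### Orthogonal polynomials from vanishing Hankel determinants. -/

section IsDomain

variable {R : Type*} [CommRing R] [IsDomain R]

theorem exists_orthogonal_of_det_eq_zero {c : ℕ → R} {m : ℕ} (h : (hankel c 1 m).det = 0) :
    ∃ f : R[X], f ≠ 0 ∧ f.degree < m ∧ ∀ i < m, moment c (f * X ^ i) = 0 := by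
  obtain ⟨v, hv, hv0⟩ := Matrix.exists_mulVec_eq_zero_iff.mpr h
  have hdeg : (∑ i : Fin m, C (v i) * X ^ (i : ℕ)).degree < (m : WithBot ℕ) :=
    degree_sum_fin_lt v
  have hco : ∀ j : Fin m, (∑ i : Fin m, C (v i) * X ^ (i : ℕ)).coeff j = v j := by
    intro j
    rw [finsetSum_coeff]
    simp [coeff_X_pow, Fin.val_inj]
  refine ⟨∑ i : Fin m, C (v i) * X ^ (i : ℕ), ?_, hdeg, fun i hi => ?_⟩
  · intro h0
    refine hv (funext fun j => ?_)
    rw [← hco j, h0]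
    simp
  · rw [← hankel_mulVec hdeg ⟨i, hi⟩]
    simp only [hco]
    rw [show (fun j => v j) = v from rfl, hv0]
    rfl

theorem eq_zero_of_orthogonal {c : ℕ → R} {m : ℕ} (h : (hankel c 1 m).det ≠ 0) {f : R[X]}
    (hf : f.degree < m) (ho : ∀ i < m, moment c (f * X ^ i) = 0) : f = 0 := by
  have h0 : (hankel c 1 m).mulVec (fun j => f.coeff j) = 0 :=
    funext fun i => by rw [hankel_mulVec hf, ho i i.2]; rfl
  have h1 := Matrix.eq_zero_of_mulVec_eq_zero h h0
  rw [← sum_fin_C_mul_X_pow hf]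
  exact Finset.sum_eq_zero fun i _ => by rw [show f.coeff i = 0 from congrFun h1 i]; simp

/-- If `n` is the last index before `M` with a nonzero Hankel determinant, then some polynomial of
degree `n` is orthogonal to all the powers of `X` below `M`. -/
theorem exists_orthogonal {c : ℕ → R} {n M : ℕ} (hnM : n < M) (hn : (hankel c 1 n).det ≠ 0)
    (hM : ∀ m, n < m → m ≤ M → (hankel c 1 m).det = 0) :
    ∃ Q : R[X], Q ≠ 0 ∧ Q.natDegree = n ∧ ∀ j < M, moment c (Q * X ^ j) = 0 := by
  obtain ⟨Q, hQ0, hQd, hQ⟩ := exists_orthogonal_of_det_eq_zero (hM (n + 1) (by omega) (by omega))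
  have hdeg : Q.natDegree = n := by
    have h1 : Q.natDegree < n + 1 := (natDegree_lt_iff_degree_lt hQ0).mpr hQd
    by_contra h2
    refine hQ0 (eq_zero_of_orthogonal hn ?_ fun i hi => hQ i (by omega))
    exact (natDegree_lt_iff_degree_lt hQ0).mp (by omega)
  refine ⟨Q, hQ0, hdeg, fun j => ?_⟩
  induction j using Nat.strong_induction_on with
  | _ j ih =>
    intro hj
    by_cases hjn : j ≤ n
    · exact hQ j (by omega)
    by_contra hd
    -- With `d` the degree of `f`, the functional kills $f \cdot Q X^{j-d}$ because $\deg (Q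
    -- X^{j-d}) \le j$. Expanding `f` instead, induction kills every term but the leading one, which
    -- forces the moment of $Q X^j$ to vanish.
    obtain ⟨f, hf0, hfd, hf⟩ := exists_orthogonal_of_det_eq_zero (hM (j + 1) (by omega) (by omega))
    have hfd' : f.natDegree < j + 1 := (natDegree_lt_iff_degree_lt hf0).mpr hfd
    by_cases hfn : f.natDegree < n
    · exact hf0 (eq_zero_of_orthogonal hn ((natDegree_lt_iff_degree_lt hf0).mp hfn)
        fun i hi => hf i (by omega))
    set d := f.natDegree with hdd
    have h1 : moment c (f * (Q * X ^ (j - d))) = 0 := by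
      refine moment_eq_zero_of_degree_lt (m := j + 1) ?_ hf
      refine (natDegree_lt_iff_degree_lt (mul_ne_zero hQ0 (pow_ne_zero _ X_ne_zero))).mp ?_
      rw [natDegree_mul hQ0 (pow_ne_zero _ X_ne_zero), natDegree_X_pow, hdeg]
      omega
    have h2 : moment c (f * (Q * X ^ (j - d))) =
        ∑ l ∈ Finset.range (d + 1), f.coeff l * moment c (Q * X ^ (l + (j - d))) := by
      conv_lhs => rw [f.as_sum_range_C_mul_X_pow, Finset.sum_mul, map_sum]
      refine Finset.sum_congr rfl fun l _ => ?_
      rw [← moment_C_mul]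
      congr 1
      rw [pow_add]
      ring
    rw [h2, Finset.sum_range_succ, Finset.sum_eq_zero, zero_add, show d + (j - d) = j by omega]
      at h1
    · rcases mul_eq_zero.mp h1 with h | h
      · exact hf0 (leadingCoeff_eq_zero.mp h)
      · exact hd h
    · intro l hl
      rw [Finset.mem_range] at hl
      rw [ih _ (by omega) (by omega), mul_zero]

end IsDomain

/-! ### Degrees with integer bounds; a negative bound forces zero. -/

section DegLE

variable {R : Type*} [CommRing R]

/-- The degree of `f` is at most the integer `d`. -/
def DegLE (f : R[X]) (d : ℤ) : Prop := ∀ j : ℕ, d < j → f.coeff j = 0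

/-- The total degree of the bivariate polynomial `P` is at most the integer `d`. -/
def TotLE (P : R[X][X]) (d : ℤ) : Prop := ∀ j : ℕ, DegLE (P.coeff j) (d - j)

namespace DegLE

variable {f g : R[X]} {d e : ℤ}

theorem zero (d : ℤ) : DegLE (0 : R[X]) d := fun _ _ => coeff_zero _

theorem mono (hf : DegLE f d) (h : d ≤ e) : DegLE f e := fun j hj => hf j (by omega)

theorem add (hf : DegLE f d) (hg : DegLE g d) : DegLE (f + g) d := fun j hj => by
  rw [coeff_add, hf j hj, hg j hj, add_zero]

theorem sub (hf : DegLE f d) (hg : DegLE g d) : DegLE (f - g) d := fun j hj => by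
  rw [coeff_sub, hf j hj, hg j hj, sub_zero]

theorem mul (hf : DegLE f d) (hg : DegLE g e) : DegLE (f * g) (d + e) := fun j hj => by
  rw [coeff_mul]
  refine Finset.sum_eq_zero fun p hp => ?_
  rw [Finset.HasAntidiagonal.mem_antidiagonal] at hp
  by_cases h : d < p.1
  · rw [hf _ h, zero_mul]
  · rw [hg _ (by omega), mul_zero]

theorem sum {ι : Type*} {s : Finset ι} {f : ι → R[X]} (h : ∀ i ∈ s, DegLE (f i) d) :
    DegLE (∑ i ∈ s, f i) d := fun j hj => by
  rw [finsetSum_coeff]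
  exact Finset.sum_eq_zero fun i hi => h i hi j hj

theorem C (a : R) : DegLE (C a) 0 := fun j hj => coeff_C_of_ne_zero (by omega)

theorem one : DegLE (1 : R[X]) 0 := by simpa using DegLE.C (1 : R)

theorem X : DegLE (X : R[X]) 1 := fun j hj => coeff_X_of_ne_one (by omega)

theorem prod {ι : Type*} {s : Finset ι} {f : ι → R[X]} {d : ι → ℤ}
    (h : ∀ i ∈ s, DegLE (f i) (d i)) : DegLE (∏ i ∈ s, f i) (∑ i ∈ s, d i) := by
  classical
  induction s using Finset.induction_on with
  | empty => simpa using DegLE.one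
  | insert a s ha ih =>
    rw [Finset.prod_insert ha, Finset.sum_insert ha]
    exact (h a (by simp)).mul (ih fun i hi => h i (by simp [hi]))

theorem natDegree_le (hf : DegLE f d) (h0 : f ≠ 0) : (f.natDegree : ℤ) ≤ d := by
  by_contra h
  exact h0 (leadingCoeff_eq_zero.mp (hf _ (by omega)))

theorem map {S : Type*} [CommRing S] (φ : R →+* S) (hf : DegLE f d) : DegLE (f.map φ) d :=
  fun j hj => by rw [coeff_map, hf j hj, map_zero]

end DegLE

namespace TotLE

variable {P Q : R[X][X]} {d e : ℤ}

theorem mono (hf : TotLE P d) (h : d ≤ e) : TotLE P e := fun j => (hf j).mono (by omega)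

theorem sub (hP : TotLE P d) (hQ : TotLE Q d) : TotLE (P - Q) d := fun j => by
  rw [coeff_sub]
  exact (hP j).sub (hQ j)

theorem mul (hP : TotLE P d) (hQ : TotLE Q e) : TotLE (P * Q) (d + e) := fun j => by
  rw [coeff_mul]
  refine DegLE.sum fun p hp => ?_
  rw [Finset.HasAntidiagonal.mem_antidiagonal] at hp
  exact ((hP _).mul (hQ _)).mono (by omega)

theorem C {f : R[X]} (hf : DegLE f d) : TotLE (C f) d := fun j => by
  rw [coeff_C]
  split_ifs with h
  · exact hf.mono (by omega)
  · exact DegLE.zero _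

theorem one : TotLE (1 : R[X][X]) 0 := by simpa using TotLE.C (DegLE.one (R := R))

theorem X : TotLE (X : R[X][X]) 1 := fun j => by
  rw [coeff_X]
  split_ifs with h
  · exact DegLE.one.mono (by omega)
  · exact DegLE.zero _

theorem pow (hP : TotLE P d) (n : ℕ) : TotLE (P ^ n) (n * d) := by
  induction n with
  | zero => simpa using TotLE.one
  | succ n ih =>
    rw [pow_succ]
    exact (ih.mul hP).mono (by push_cast; linarith)

end TotLE

theorem moment_degLE {c : ℕ → R[X]} {e d : ℤ} (hc : ∀ i, DegLE (c i) (e + i)) {P : R[X][X]}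
    (hP : TotLE P d) : DegLE (moment c P) (d + e) := by
  rw [moment_apply, sum_def]
  exact DegLE.sum fun i _ => ((hP i).mul (hc i)).mono (by omega)

/-- In the Leibniz expansion the entry $(\sigma(i), i)$ has degree at most $d + e + \sigma(i) + i$,
and the sum over $i$ does not depend on $\sigma$. -/
theorem det_hankel_degLE {c : ℕ → R[X]} {e d : ℤ} (hc : ∀ i, DegLE (c i) (e + i)) {g : R[X][X]}
    (hg : TotLE g d) (n : ℕ) : DegLE (hankel c g n).det (n * (d + e + n - 1)) := by
  rw [Matrix.det_apply']
  refine DegLE.sum fun σ _ => ?_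
  have h1 : DegLE (∏ i, hankel c g n (σ i) i) (∑ i : Fin n, (d + e + (σ i : ℕ) + (i : ℕ))) := by
    refine DegLE.prod fun i _ => ?_
    have h2 := (hg.mul (TotLE.X.pow (σ i : ℕ))).mul (TotLE.X.pow (i : ℕ))
    exact (moment_degLE hc h2).mono (by linarith)
  have h3 : ∑ i : Fin n, (d + e + (σ i : ℕ) + (i : ℕ)) = n * (d + e + n - 1) := by
    rw [Finset.sum_add_distrib, Finset.sum_add_distrib,
      Equiv.sum_comp σ (fun i : Fin n => ((i : ℕ) : ℤ)), add_assoc,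
      Fin.sum_univ_eq_sum_range (fun i => (i : ℤ)) n]
    have h4 : ∀ n : ℕ, ∑ i ∈ Finset.range n, (i : ℤ) + ∑ i ∈ Finset.range n, (i : ℤ) =
        n * (n - 1) := by
      intro n
      induction n with
      | zero => simp
      | succ n ih =>
        rw [Finset.sum_range_succ]
        push_cast
        linarith
    rw [h4]
    simp only [Finset.sum_const, Finset.card_univ, Fintype.card_fin, nsmul_eq_mul]
    ring
  rw [← h3]
  have h5 : DegLE ((((Equiv.Perm.sign σ : ℤˣ) : ℤ) : R[X])) 0 := by
    simpa using DegLE.C ((((Equiv.Perm.sign σ : ℤˣ) : ℤ) : R))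
  simpa using h5.mul h1

end DegLE

/-! ### Moments under change of coefficient ring. -/

section Map

variable {R S : Type*} [CommRing R] [CommRing S]

theorem moment_map (φ : R →+* S) (c : ℕ → R) (P : R[X]) :
    moment (fun i => φ (c i)) (P.map φ) = φ (moment c P) := by
  induction P using Polynomial.induction_on' with
  | add p q hp hq => rw [Polynomial.map_add, map_add, map_add, map_add, hp, hq]
  | monomial n a =>
    rw [map_monomial, ← C_mul_X_pow_eq_monomial, ← C_mul_X_pow_eq_monomial, moment_C_mul,
      moment_C_mul, moment_X_pow, moment_X_pow, map_mul]

theorem det_hankel_map (φ : R →+* S) (c : ℕ → R) (P : R[X]) (n : ℕ) :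
    (hankel (fun i => φ (c i)) (P.map φ) n).det = φ (hankel c P n).det := by
  rw [RingHom.map_det]
  congr 1
  ext i j
  simp only [hankel, Matrix.of_apply, RingHom.mapMatrix_apply, Matrix.map_apply]
  rw [← moment_map]
  simp

theorem dvd_moment_mul {c : ℕ → R} {π : R} {b : R[X]} (h : ∀ j, π ∣ moment c (b * X ^ j))
    (g : R[X]) : π ∣ moment c (b * g) := by
  rw [g.as_sum_range_C_mul_X_pow, Finset.mul_sum, map_sum]
  refine Finset.dvd_sum fun i _ => ?_
  rw [mul_left_comm, moment_C_mul]
  exact (h i).mul_left _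

end Map

/-! ### Degree counting: vanishing determinants and the total degree of the orthogonal polynomial.
-/

section Field

variable {F : Type*} [Field F]

/-- The moments `c`, specialized at each `y` in `K`, are those of a functional vanishing on the
ideal generated by a monic polynomial of degree `t`. -/
def VanishAt (c : ℕ → F[X]) (K : Finset F) (t : ℕ) : Prop :=
  ∀ y ∈ K, ∃ b : F[X][X], b.Monic ∧ b.natDegree = t ∧ ∀ j, (X - C y) ∣ moment c (b * X ^ j)

/-- The monic polynomial vanishing to the order `s` at the elements of `K`. -/
noncomputable def nodal (K : Finset F) (s : ℕ) : F[X] := ∏ y ∈ K, (X - C y) ^ s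

theorem nodal_monic (K : Finset F) (s : ℕ) : (nodal K s).Monic :=
  monic_prod_of_monic _ _ fun y _ => (monic_X_sub_C y).pow s

theorem natDegree_nodal (K : Finset F) (s : ℕ) : (nodal K s).natDegree = K.card * s := by
  rw [nodal, natDegree_prod_of_monic _ _ fun y _ => (monic_X_sub_C y).pow s]
  simp

theorem nodal_dvd {K : Finset F} {s : ℕ} {f : F[X]} (h : ∀ y ∈ K, (X - C y) ^ s ∣ f) :
    nodal K s ∣ f := by
  refine Finset.prod_dvd_of_coprime (fun y _ z _ hyz => ?_) h
  exact (isCoprime_X_sub_C_of_isUnit_sub (sub_ne_zero.mpr hyz).isUnit).pow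

theorem VanishAt.nodal_dvd_det {c : ℕ → F[X]} {K : Finset F} {t : ℕ} (h : VanishAt c K t)
    (g : F[X][X]) (m : ℕ) : nodal K (m - t) ∣ (hankel c g m).det := by
  refine nodal_dvd fun y hy => ?_
  obtain ⟨b, hb, rfl, hd⟩ := h y hy
  exact pow_dvd_det_hankel hb (dvd_moment_mul hd) g m

theorem VanishAt.map {E : Type*} [Field E] (φ : F →+* E) {c : ℕ → F[X]} {K : Finset F} {t : ℕ}
    (h : VanishAt c K t) :
    VanishAt (fun i => (c i).map φ) (K.map ⟨φ, φ.injective⟩) t := by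
  intro y hy
  obtain ⟨z, hz, rfl⟩ := Finset.mem_map.mp hy
  obtain ⟨b, hb, hbt, hd⟩ := h z hz
  refine ⟨b.map (mapRingHom φ), hb.map _, by rw [hb.natDegree_map, hbt], fun j => ?_⟩
  have h1 := moment_map (mapRingHom φ) c (b * X ^ j)
  rw [Polynomial.map_mul, Polynomial.map_pow, map_X] at h1
  have h2 := map_dvd (mapRingHom φ) (hd j)
  rw [← h1] at h2
  simpa using h2

/-- The determinant is divisible by `nodal K (m - t)`, whose degree exceeds the bound of
`det_hankel_degLE`. -/
theorem VanishAt.det_eq_zero {c : ℕ → F[X]} {K : Finset F} {t : ℕ} (h : VanishAt c K t) {e : ℤ}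
    (hc : ∀ i, DegLE (c i) (e + i)) {m : ℕ}
    (hm : (m : ℤ) * (e + m - 1) < K.card * (m - t : ℕ)) : (hankel c 1 m).det = 0 := by
  by_contra h0
  have h1 := (det_hankel_degLE hc TotLE.one m).natDegree_le h0
  have h2 := natDegree_le_of_dvd (h.nodal_dvd_det 1 m) h0
  rw [natDegree_nodal] at h2
  have h3 : ((K.card * (m - t : ℕ) : ℕ) : ℤ) ≤ (hankel c 1 m).det.natDegree := by exact_mod_cast h2
  push_cast at h3
  rw [zero_add] at h1
  omega

/-- The recursion between twisted Hankel determinants, iterated. -/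
theorem coeff_pow_mul_det_hankel {R : Type*} [CommRing R] {c : ℕ → R} {Q : R[X]} {n M : ℕ}
    (hn : n ≠ 0) (hQ : Q.natDegree ≤ n) (hM : ∀ j < M, moment c (Q * X ^ j) = 0) (a : R) {i : ℕ}
    (hi : i + n ≤ M + 1) :
    Q.coeff n ^ i * (hankel c ((X - C a) ^ i) n).det =
      ((-1) ^ n * Q.eval a) ^ i * (hankel c 1 n).det := by
  induction i with
  | zero => simp
  | succ i ih =>
    rw [pow_succ, mul_assoc, coeff_mul_det_hankel_succ hn hQ hM a (by omega), mul_left_comm,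
      ih (by omega), pow_succ]
    ring

/-- A bivariate polynomial of total degree more than `d` keeps a degree more than `d` on some
line, which can also be chosen such that the restriction is coprime to the leading coefficient. -/
theorem exists_line_of_not_totLE {E : Type*} [Field E] [Algebra F E] [IsAlgClosed E]
    [Algebra.IsAlgebraic F E] {Q : F[X][X]} (hQ : Q.IsPrimitive) {n : ℕ} (hQn : Q.natDegree = n)
    {d : ℕ} (hd : ¬ TotLE Q d) :
    ∃ l : E[X], DegLE l 1 ∧ d < ((Q.map (mapRingHom (algebraMap F E))).eval l).natDegree ∧
      IsCoprime ((Q.coeff n).map (algebraMap F E))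
        ((Q.map (mapRingHom (algebraMap F E))).eval l) := by
  classical
  set φ := algebraMap F E
  set QE := Q.map (mapRingHom φ) with hQE
  have hQEn : QE.natDegree = n := by
    rw [hQE, natDegree_map_eq_of_injective (map_injective φ φ.injective), hQn]
  have hco : ∀ j, QE.coeff j = (Q.coeff j).map φ := fun j => by rw [hQE, coeff_map]; rfl
  set μ := Q.support.sup fun j => j + (Q.coeff j).natDegree with hμ
  have hle : ∀ j, Q.coeff j ≠ 0 → j + (Q.coeff j).natDegree ≤ μ := fun j hj =>
    Finset.le_sup (f := fun j => j + (Q.coeff j).natDegree) (mem_support_iff.mpr hj)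
  have hdμ : d < μ := by
    by_contra h
    refine hd fun j k hk => ?_
    by_cases hj : Q.coeff j = 0
    · rw [hj, coeff_zero]
    · have := hle j hj
      exact coeff_eq_zero_of_natDegree_lt (by omega)
  obtain ⟨j₀, hj₀, hj₀μ⟩ : ∃ j ∈ Q.support, μ = j + (Q.coeff j).natDegree :=
    Finset.exists_mem_eq_sup _ (support_nonempty.mpr hQ.ne_zero) _
  -- $\theta(\alpha)$ is the coefficient of $Y^\mu$ in $Q(\alpha Y + \beta, Y)$, where $\mu$ is the
  -- total degree of $Q$; a non-root `α` preserves that degree.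
  set θ : E[X] := ∑ j ∈ Finset.range (n + 1), C ((QE.coeff j).coeff (μ - j)) * X ^ j with hθ
  have hj₀' : Q.coeff j₀ ≠ 0 := mem_support_iff.mp hj₀
  have hθ0 : θ ≠ 0 := by
    intro h
    have h1 := congrArg (fun p => p.coeff j₀) h
    have h2 : j₀ < n + 1 := by
      have := le_natDegree_of_ne_zero hj₀'
      omega
    simp only [hθ, finsetSum_coeff, coeff_C_mul, coeff_X_pow, mul_ite, mul_one, mul_zero,
      Finset.sum_ite_eq, Finset.mem_range, h2, if_true, coeff_zero, hco, coeff_map] at h1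
    rw [map_eq_zero, show μ - j₀ = (Q.coeff j₀).natDegree by omega] at h1
    exact hj₀' (leadingCoeff_eq_zero.mp h1)
  obtain ⟨α, hα⟩ := exists_eval_ne_zero_of_natDegree_lt_card θ hθ0
    (lt_of_lt_of_le (Cardinal.natCast_lt_aleph0) (Cardinal.aleph0_le_mk E))
  set L : Finset E := ((Q.coeff n).map φ).roots.toFinset with hL
  -- If all coefficients of `Q` vanished at `y`, the minimal polynomial of `y` would divide `Q`,
  -- against primitivity.
  have hsp : ∀ y : E, QE.map (evalRingHom y) ≠ 0 := by
    intro y h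
    have hint : IsIntegral F y := Algebra.IsIntegral.isIntegral y
    refine (minpoly.not_isUnit F y) (hQ _ ?_)
    rw [C_dvd_iff_dvd_coeff]
    intro j
    rw [minpoly.dvd_iff]
    have h1 := congrArg (fun p => p.coeff j) h
    have h2 : eval y ((Q.coeff j).map φ) = 0 := by simpa [hco] using h1
    rwa [eval_map_algebraMap] at h2
  -- A non-root `β` gives $Q(\alpha y + \beta, y) \ne 0$ at every root `y` of the leading
  -- coefficient, hence coprimality.
  set ψ : E[X] := ∏ y ∈ L, (QE.map (evalRingHom y)).comp (X + C (α * y)) with hψ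
  have hψ0 : ψ ≠ 0 := by
    refine Finset.prod_ne_zero_iff.mpr fun y _ h => hsp y ?_
    have h1 := congrArg (fun p => p.comp (X - C (α * y))) h
    simpa [comp_assoc] using h1
  obtain ⟨β, hβ⟩ := exists_eval_ne_zero_of_natDegree_lt_card ψ hψ0
    (lt_of_lt_of_le (Cardinal.natCast_lt_aleph0) (Cardinal.aleph0_le_mk E))
  have hldeg : (C α * X + C β).natDegree ≤ 1 := natDegree_linear_le
  refine ⟨C α * X + C β, ?_, ?_, ?_⟩
  · exact (((DegLE.C α).mul DegLE.X).mono (by omega)).add ((DegLE.C β).mono (by omega))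
  · refine lt_of_lt_of_le hdμ (le_natDegree_of_ne_zero ?_)
    convert hα using 1
    rw [eval_eq_sum_range' (Nat.lt_succ_of_le hQEn.le), finsetSum_coeff, hθ, eval_finsetSum]
    refine Finset.sum_congr rfl fun j _ => ?_
    by_cases hj : Q.coeff j = 0
    · simp [hco, hj]
    have h1 := hle j hj
    have h2 : ((C α * X + C β) ^ j).natDegree ≤ j :=
      natDegree_pow_le.trans (by nlinarith)
    conv_lhs => rw [show μ = (μ - j) + j by omega]
    rw [coeff_mul_add_eq_of_natDegree_le _ h2, eval_mul, eval_C, eval_pow, eval_X]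
    · congr 1
      have h3 := coeff_pow_of_natDegree_le (m := j) hldeg
      rw [mul_one] at h3
      rw [h3]
      simp
    · rw [hco]
      exact natDegree_map_le.trans (by omega)
  · rw [isCoprime_iff_aeval_ne_zero_of_isAlgClosed E E]
    intro y
    by_contra! h
    obtain ⟨h1, h2⟩ := h
    have hq0 : (Q.coeff n).map φ ≠ 0 := by
      rw [Ne, Polynomial.map_eq_zero, ← hQn]
      exact leadingCoeff_ne_zero.mpr hQ.ne_zero
    have hy : y ∈ L := by
      rw [hL, Multiset.mem_toFinset, mem_roots hq0]
      simpa using h1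
    rw [hψ, eval_prod] at hβ
    refine Finset.prod_ne_zero_iff.mp hβ y hy ?_
    rw [coe_aeval_eq_eval, ← coe_evalRingHom, ← eval₂_id, hom_eval₂] at h2
    rw [eval_comp, eval_map, ← h2]
    simp [add_comm]

/-- On a line $X = l(Y)$ the iterated recursion reads $q_n^i W_i = (\pm Q(l))^i W_0$ with $W_i$ the
Hankel determinant twisted by $(X-l)^i$ and $i = M - n + 1$. If $q_n$ and $Q(l)$ are coprime,
$Q(l)^i$ divides $W_i$ even after removal of the nodal factor. Comparing degrees gives $i \deg Q(l)
\le ni + n(e+n-1) - |K|(n-t)$, so $\deg Q(l) \le n + s$ on each such line. -/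
theorem totLE_of_orthogonal {c : ℕ → F[X]} {K : Finset F} {t : ℕ} (hK : VanishAt c K t) {e : ℤ}
    (hc : ∀ i, DegLE (c i) (e + i)) {Q : F[X][X]} (hQ : Q.IsPrimitive) {n M : ℕ} (hn : n ≠ 0)
    (hnM : n ≤ M) (hQn : Q.natDegree = n) (hQM : ∀ j < M, moment c (Q * X ^ j) = 0)
    (hdet : (hankel c 1 n).det ≠ 0) {s : ℕ}
    (hs : (n : ℤ) * (e + n - 1) - K.card * (n - t : ℕ) < (M - n + 1 : ℕ) * (s + 1)) :
    TotLE Q (n + s : ℕ) := by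
  by_contra hcon
  set E := AlgebraicClosure F
  obtain ⟨l, hl, hdeg, hcop⟩ :=
    exists_line_of_not_totLE (E := E) hQ hQn hcon
  set φ := algebraMap F E
  set cE : ℕ → E[X] := fun i => (c i).map φ with hcE
  set QE := Q.map (mapRingHom φ) with hQE
  set i := M - n + 1 with hi
  have hcE' : ∀ i, DegLE (cE i) (e + i) := fun i => (hc i).map φ
  have horth : ∀ j < M, moment cE (QE * X ^ j) = 0 := by
    intro j hj
    have h1 := moment_map (mapRingHom φ) c (Q * X ^ j)
    rw [hQM j hj, map_zero, Polynomial.map_mul, Polynomial.map_pow, map_X] at h1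
    exact h1
  have hW0 : (hankel cE 1 n).det ≠ 0 := by
    have h1 := det_hankel_map (mapRingHom φ) c 1 n
    rw [Polynomial.map_one] at h1
    rw [show (hankel cE 1 n).det = _ from h1]
    exact (map_ne_zero_iff _ (map_injective φ φ.injective)).mpr hdet
  have hrec := coeff_pow_mul_det_hankel hn (natDegree_map_le.trans hQn.le) horth l (i := i)
    (by omega)
  rw [show QE.coeff n = (Q.coeff n).map φ by rw [hQE, coeff_map]; rfl] at hrec
  obtain ⟨A, hA⟩ := (hK.map φ).nodal_dvd_det 1 n
  obtain ⟨B, hB⟩ := (hK.map φ).nodal_dvd_det ((X - C l) ^ i) n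
  change (hankel cE 1 n).det = _ at hA
  change (hankel cE ((X - C l) ^ i) n).det = _ at hB
  set κ := nodal (K.map ⟨φ, φ.injective⟩) (n - t) with hκ
  have hκ0 : κ ≠ 0 := (nodal_monic _ _).ne_zero
  have hκd : κ.natDegree = K.card * (n - t) := by rw [hκ, natDegree_nodal, Finset.card_map]
  have hA0 : A ≠ 0 := fun h => hW0 (by rw [hA, h, mul_zero])
  have hrec' : (Q.coeff n).map φ ^ i * B = ((-1) ^ n * QE.eval l) ^ i * A := by
    refine mul_left_cancel₀ hκ0 ?_
    rw [hA, hB] at hrec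
    linear_combination hrec
  have hcop' : IsCoprime ((Q.coeff n).map φ ^ i) (((-1) ^ n * QE.eval l) ^ i) := by
    refine IsCoprime.pow (IsCoprime.mul_right ?_ hcop)
    exact (isCoprime_one_right.neg_right).pow_right
  obtain ⟨V, hV⟩ := hcop'.dvd_of_dvd_mul_left (Dvd.intro _ hrec')
  have hq0 : (Q.coeff n).map φ ≠ 0 := by
    rw [Ne, Polynomial.map_eq_zero, ← hQn]
    exact leadingCoeff_ne_zero.mpr hQ.ne_zero
  have hB' : B = ((-1) ^ n * QE.eval l) ^ i * V := by
    refine mul_left_cancel₀ (pow_ne_zero i hq0) ?_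
    rw [hrec', hV]
    ring
  have hV0 : V ≠ 0 := fun h => hA0 (by rw [hV, h, mul_zero])
  have he0 : QE.eval l ≠ 0 := fun h => by simp [h] at hdeg
  have hs0 : ((-1) ^ n * QE.eval l) ≠ 0 :=
    mul_ne_zero (pow_ne_zero _ (neg_ne_zero.mpr one_ne_zero)) he0
  have hsd : ((-1) ^ n * QE.eval l).natDegree = (QE.eval l).natDegree := by
    rcases neg_one_pow_eq_or E[X] n with h | h <;> simp [h]
  have hBd : i * (QE.eval l).natDegree ≤ B.natDegree := by
    rw [hB', natDegree_mul (pow_ne_zero _ hs0) hV0, natDegree_pow, hsd]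
    omega
  have hB0 : B ≠ 0 := by
    rw [hB']
    exact mul_ne_zero (pow_ne_zero _ hs0) hV0
  have hlin : TotLE ((X - C l) ^ i) (i * 1) := (TotLE.X.sub (TotLE.C hl)).pow i
  have hWd := (det_hankel_degLE hcE' hlin n).natDegree_le (by rw [hB]; exact mul_ne_zero hκ0 hB0)
  rw [hB, natDegree_mul hκ0 hB0, hκd] at hWd
  have h1 : (i : ℤ) * (n + s + 1) ≤ i * (QE.eval l).natDegree :=
    mul_le_mul_of_nonneg_left (by exact_mod_cast hdeg) (by omega)
  have h2 : (i : ℤ) * (QE.eval l).natDegree ≤ B.natDegree := by exact_mod_cast hBd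
  push_cast at hWd
  nlinarith

theorem exists_isPrimitive_orthogonal {c : ℕ → F[X]} {n M : ℕ} (hnM : n < M)
    (hn : (hankel c 1 n).det ≠ 0) (hM : ∀ m, n < m → m ≤ M → (hankel c 1 m).det = 0) :
    ∃ Q : F[X][X], Q.IsPrimitive ∧ Q.natDegree = n ∧ ∀ j < M, moment c (Q * X ^ j) = 0 := by
  let _ : NormalizedGCDMonoid F[X] := Classical.choice inferInstance
  obtain ⟨Q, hQ0, hQn, hQ⟩ := exists_orthogonal hnM hn hM
  refine ⟨Q.primPart, Q.isPrimitive_primPart, by rw [natDegree_primPart, hQn], fun j hj => ?_⟩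
  have h1 := hQ j hj
  rw [Q.eq_C_content_mul_primPart, mul_assoc, moment_C_mul] at h1
  exact (mul_eq_zero.mp h1).resolve_left (mt content_eq_zero_iff.mp hQ0)

end Field

theorem moment_sum_pow {R ι : Type*} [CommRing R] (s : Finset ι) (a w : ι → R) (f : R[X]) :
    moment (fun i => ∑ x ∈ s, a x ^ i * w x) f = ∑ x ∈ s, f.eval (a x) * w x := by
  induction f using Polynomial.induction_on' with
  | add p q hp hq => simp only [map_add, hp, hq, eval_add, add_mul, Finset.sum_add_distrib]
  | monomial n r =>
    rw [← C_mul_X_pow_eq_monomial, moment_C_mul, moment_X_pow, Finset.mul_sum]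
    simp [mul_assoc]

theorem moment_mul_X_pow {R : Type*} [CommRing R] (c : ℕ → R) {Q : R[X]} {n : ℕ}
    (hQ : Q.natDegree ≤ n) (j : ℕ) :
    moment c (Q * X ^ j) = ∑ l ∈ Finset.range (n + 1), Q.coeff l * c (l + j) := by
  conv_lhs => rw [Q.as_sum_range_C_mul_X_pow' (Nat.lt_succ_of_le hQ), Finset.sum_mul, map_sum]
  refine Finset.sum_congr rfl fun l _ => ?_
  rw [mul_assoc, moment_C_mul, ← pow_add, moment_X_pow]

/-- A polynomial orthogonal to enough powers with respect to a weighted sum of evaluations vanishes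
at the support of the weight. -/
theorem eval_eq_zero_of_sum_eq_zero {F : Type*} [Field F] [Fintype F] {w : F → F} {T : Finset F}
    (hT : ∀ x, w x ≠ 0 → x ∈ T) {M : ℕ} (hM : T.card ≤ M) {Q : F[X]}
    (h : ∀ j < M, ∑ x, Q.eval x * x ^ j * w x = 0) {x : F} (hx : w x ≠ 0) : Q.eval x = 0 := by
  classical
  have hg : ∀ g : F[X], g.degree < M → ∑ x, Q.eval x * g.eval x * w x = 0 := by
    intro g hg
    have h1 := moment_eq_zero_of_degree_lt (c := fun i => ∑ x, x ^ i * w x) (g := Q) hg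
      (fun i hi => by
        rw [moment_sum_pow]
        simpa using h i hi)
    rw [moment_sum_pow] at h1
    simpa using h1
  have h2 := hg (∏ z ∈ T.erase x, (X - C z)) (by
    rw [degree_prod]
    simp only [degree_X_sub_C, Finset.sum_const, nsmul_eq_mul, mul_one]
    have := Finset.card_erase_lt_of_mem (hT x hx)
    exact_mod_cast lt_of_lt_of_le this hM)
  rw [Finset.sum_eq_single x] at h2
  · rcases mul_eq_zero.mp h2 with h3 | h3
    · rcases mul_eq_zero.mp h3 with h4 | h4
      · exact h4
      · rw [eval_prod, Finset.prod_eq_zero_iff] at h4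
        obtain ⟨z, hz, hz'⟩ := h4
        rw [eval_sub, eval_X, eval_C, sub_eq_zero] at hz'
        exact absurd hz'.symm (Finset.ne_of_mem_erase hz)
    · exact absurd h3 hx
  · intro z _ hz
    by_cases hw : w z = 0
    · rw [hw, mul_zero]
    · rw [eval_prod, Finset.prod_eq_zero (Finset.mem_erase.mpr ⟨hz, hT z hw⟩), mul_zero, zero_mul]
      simp
  · simp

/-! ### The Rédei polynomial, its moments and their part at infinity. -/

section Redei

variable {F : Type*} [Field F]

/-- The Rédei polynomial of the set `U` of affine points. -/
noncomputable def redei (U : Finset (F × F)) : F[X][X] :=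
  ∏ u ∈ U, (X - C (C u.1 * X - C u.2))

theorem natDegree_redei (U : Finset (F × F)) : (redei U).natDegree = U.card := by
  rw [redei, natDegree_prod_of_monic _ _ fun _ _ => monic_X_sub_C _]
  simp only [natDegree_X_sub_C, Finset.sum_const, smul_eq_mul, mul_one]

theorem degLE_line (a b : F) : DegLE (C a * X - C b) 1 :=
  (((DegLE.C a).mul DegLE.X).mono (by omega)).sub ((DegLE.C b).mono (by omega))

theorem redei_totLE (U : Finset (F × F)) : TotLE (redei U) U.card := by
  classical
  induction U using Finset.induction_on with
  | empty => simpa [redei] using TotLE.one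
  | insert u U hu ih =>
    rw [redei, Finset.prod_insert hu, Finset.card_insert_of_notMem hu]
    exact ((TotLE.X.sub (TotLE.C (degLE_line u.1 u.2))).mul ih).mono (by push_cast; omega)

theorem eval_redei (U : Finset (F × F)) (x y : F) :
    ((redei U).eval (C x)).eval y = ∏ u ∈ U, (x - (u.1 * y - u.2)) := by
  simp [redei, eval_prod]

/-- The polynomial obtained from `P`, of total degree at most `d`, at the infinite value of the
inner variable. -/
noncomputable def atInfinity (d : ℕ) (P : F[X][X]) : F[X] :=
  ∑ l ∈ Finset.range (d + 1), C ((P.coeff l).coeff (d - l)) * X ^ l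

theorem coeff_atInfinity {d : ℕ} (P : F[X][X]) {l : ℕ} (hl : l ≤ d) :
    (atInfinity d P).coeff l = (P.coeff l).coeff (d - l) := by
  simp [atInfinity, finsetSum_coeff, coeff_X_pow, Nat.lt_succ_of_le hl]

theorem natDegree_atInfinity_le (d : ℕ) (P : F[X][X]) : (atInfinity d P).natDegree ≤ d := by
  refine natDegree_sum_le_of_forall_le _ _ fun l hl => ?_
  exact (natDegree_C_mul_X_pow_le _ _).trans (by simpa [Nat.lt_succ_iff] using hl)

theorem TotLE.coeff_eq_zero {P : F[X][X]} {d : ℤ} (hP : TotLE P d) {j : ℕ} (hj : d < j) :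
    P.coeff j = 0 := by
  ext k
  exact hP j k (by omega)

theorem TotLE.natDegree_coeff_le {P : F[X][X]} {d : ℕ} (hP : TotLE P d) (j : ℕ) :
    (P.coeff j).natDegree ≤ d - j := by
  by_cases h0 : P.coeff j = 0
  · simp [h0]
  · have := (hP j).natDegree_le h0
    omega

theorem coeff_atInfinity_eq_zero {d : ℕ} (P : F[X][X]) {l : ℕ} (hl : d < l) :
    (atInfinity d P).coeff l = 0 :=
  coeff_eq_zero_of_natDegree_lt (lt_of_le_of_lt (natDegree_atInfinity_le _ _) hl)

theorem atInfinity_line_mul {P : F[X][X]} {d : ℕ} (hP : TotLE P d) (a b : F) :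
    atInfinity (d + 1) ((X - C (C a * X - C b)) * P) = (X - C a) * atInfinity d P := by
  have hl1 : (C a * X - C b : F[X]).natDegree ≤ 1 := by
    by_cases h0 : (C a * X - C b : F[X]) = 0
    · rw [h0, natDegree_zero]
      omega
    · exact_mod_cast (degLE_line a b).natDegree_le h0
  have hl2 : (C a * X - C b : F[X]).coeff 1 = a := by simp
  generalize (C a * X - C b : F[X]) = f at *
  have h1 : ∀ l, l ≤ d + 1 → (f * P.coeff l).coeff (d + 1 - l) = a * (atInfinity d P).coeff l := by
    intro l hl
    by_cases hld : l ≤ d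
    · rw [coeff_atInfinity P hld, show d + 1 - l = 1 + (d - l) by omega,
        coeff_mul_add_eq_of_natDegree_le hl1 (hP.natDegree_coeff_le l), hl2]
    · rw [hP.coeff_eq_zero (by omega), coeff_atInfinity_eq_zero P (by omega), mul_zero, mul_zero,
        coeff_zero]
  rw [sub_mul, sub_mul]
  ext l
  rw [coeff_sub, coeff_C_mul]
  by_cases hl : l ≤ d + 1
  · rw [coeff_atInfinity _ hl, coeff_sub, coeff_C_mul, coeff_sub, h1 l hl]
    congr 1
    rcases l with _ | l
    · simp
    · rw [coeff_X_mul, coeff_X_mul, coeff_atInfinity _ (by omega)]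
      congr 1
      omega
  · rcases l with _ | l
    · omega
    · rw [coeff_X_mul, coeff_atInfinity_eq_zero P (by omega), coeff_atInfinity_eq_zero P (by omega),
        coeff_atInfinity_eq_zero _ (by omega)]
      simp

theorem atInfinity_redei (U : Finset (F × F)) :
    atInfinity U.card (redei U) = ∏ u ∈ U, (X - C u.1) := by
  classical
  induction U using Finset.induction_on with
  | empty => simp [atInfinity, redei]
  | insert u U hu ih =>
    rw [Finset.prod_insert hu, ← ih, ← atInfinity_line_mul (redei_totLE U) u.1 u.2,
      Finset.card_insert_of_notMem hu, redei, Finset.prod_insert hu, redei]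

variable [Fintype F]

/-- The power sums over `F` weighted by the values of the Rédei polynomial. -/
noncomputable def redeiMoment (U : Finset (F × F)) (i : ℕ) : F[X] :=
  ∑ x : F, C x ^ i * (redei U).eval (C x)

theorem redeiMoment_eq (U : Finset (F × F)) (i : ℕ) :
    redeiMoment U i =
      ∑ j ∈ Finset.range (U.card + 1), (redei U).coeff j * C (∑ x : F, x ^ (i + j)) := by
  simp only [redeiMoment]
  simp_rw [eval_eq_sum_range' (Nat.lt_succ_of_le (natDegree_redei U).le), Finset.mul_sum]
  rw [Finset.sum_comm]
  refine Finset.sum_congr rfl fun j _ => ?_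
  rw [map_sum, Finset.mul_sum]
  refine Finset.sum_congr rfl fun x _ => ?_
  rw [C_pow, pow_add]
  ring

/-- Power sums with exponent below $q-1$ vanish, so only coefficients of $X^j$ with $j \ge q-1-i$
enter, and these have degree at most $|U| - j$. -/
theorem redeiMoment_degLE (U : Finset (F × F)) (i : ℕ) :
    DegLE (redeiMoment U i) ((U.card : ℤ) + 1 - Fintype.card F + i) := by
  rw [redeiMoment_eq]
  refine DegLE.sum fun j _ => ?_
  by_cases hij : i + j < Fintype.card F - 1
  · rw [FiniteField.sum_pow_lt_card_sub_one F _ hij, C_0, mul_zero]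
    exact DegLE.zero _
  · exact ((redei_totLE U j).mul (DegLE.C _)).mono (by omega)

theorem sum_pow_eq_zero_of_lt {m : ℕ} (h1 : Fintype.card F - 1 < m)
    (h2 : m < 2 * (Fintype.card F - 1)) : ∑ x : F, x ^ m = 0 := by
  have h : ∀ x : F, x ^ m = x ^ (m - (Fintype.card F - 1)) := by
    intro x
    conv_lhs => rw [show m = Fintype.card F + (m - Fintype.card F) by omega, pow_add,
      FiniteField.pow_card, ← pow_succ']
    congr 1
    have := Fintype.card_pos (α := F)
    omega
  simp_rw [h]
  exact FiniteField.sum_pow_lt_card_sub_one F _ (by omega)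

/-- The weighted power sums at infinity. -/
noncomputable def redeiMomentInfinity (U : Finset (F × F)) (i : ℕ) : F :=
  ∑ x : F, x ^ i * ∏ u ∈ U, (x - u.1)

theorem redeiMomentInfinity_eq (U : Finset (F × F)) (i : ℕ) :
    redeiMomentInfinity U i = ∑ j ∈ Finset.range (U.card + 1),
      ((redei U).coeff j).coeff (U.card - j) * ∑ x : F, x ^ (i + j) := by
  have h : ∀ x : F, ∏ u ∈ U, (x - u.1) = (atInfinity U.card (redei U)).eval x := by
    intro x
    rw [atInfinity_redei, eval_prod]
    simp
  simp_rw [redeiMomentInfinity, h, atInfinity, eval_finsetSum, Finset.mul_sum]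
  rw [Finset.sum_comm]
  refine Finset.sum_congr rfl fun j _ => Finset.sum_congr rfl fun x _ => ?_
  rw [pow_add]
  simp
  ring

theorem redeiMomentInfinity_eq_zero (U : Finset (F × F)) {i : ℕ}
    (h : U.card + i < Fintype.card F - 1) : redeiMomentInfinity U i = 0 := by
  rw [redeiMomentInfinity_eq]
  refine Finset.sum_eq_zero fun j hj => ?_
  rw [Finset.mem_range] at hj
  rw [FiniteField.sum_pow_lt_card_sub_one F _ (by omega), mul_zero]

/-- For exponents below $2(q-1)$ only $i + j = q-1$ has a nonzero power sum, and there the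
coefficient compared is the top one on both sides. -/
theorem coeff_redeiMoment (U : Finset (F × F)) {i : ℕ}
    (h2 : U.card + i < 2 * (Fintype.card F - 1)) :
    (redeiMoment U i).coeff (U.card + i - (Fintype.card F - 1)) = redeiMomentInfinity U i := by
  rw [redeiMomentInfinity_eq, redeiMoment_eq, finsetSum_coeff]
  refine Finset.sum_congr rfl fun j hj => ?_
  rw [Finset.mem_range] at hj
  rw [coeff_mul_C]
  rcases lt_trichotomy (i + j) (Fintype.card F - 1) with h | h | h
  · rw [FiniteField.sum_pow_lt_card_sub_one F _ h, mul_zero, mul_zero]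
  · congr 2
    omega
  · rw [sum_pow_eq_zero_of_lt h (by omega), mul_zero, mul_zero]

/-- This is the coefficient of the highest possible power of $Y$ in the orthogonality relation; it
transfers orthogonality to the vertical direction. -/
theorem sum_atInfinity_eq_zero (U : Finset (F × F)) {Q : F[X][X]} {μ n j : ℕ} (hμ : TotLE Q μ)
    (hn : Q.natDegree ≤ n) (hnμ : n ≤ μ) (hj : U.card + n + j < 2 * (Fintype.card F - 1))
    (h : moment (redeiMoment U) (Q * X ^ j) = 0) :
    ∑ x, (atInfinity μ Q).eval x * x ^ j * ∏ u ∈ U, (x - u.1) = 0 := by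
  have h1 : ∑ x, (atInfinity μ Q).eval x * x ^ j * ∏ u ∈ U, (x - u.1) =
      ∑ l ∈ Finset.range (n + 1), (Q.coeff l).coeff (μ - l) * redeiMomentInfinity U (l + j) := by
    have h2 : (atInfinity μ Q).natDegree ≤ n := by
      refine natDegree_le_iff_coeff_eq_zero.mpr fun l hl => ?_
      by_cases hlμ : l ≤ μ
      · rw [coeff_atInfinity _ hlμ, coeff_eq_zero_of_natDegree_lt (lt_of_le_of_lt hn hl), coeff_zero]
      · exact coeff_eq_zero_of_natDegree_lt
          (lt_of_le_of_lt (natDegree_atInfinity_le _ _) (by omega))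
    have h3 := moment_mul_X_pow (redeiMomentInfinity U) h2 j
    rw [show redeiMomentInfinity U = fun i => ∑ x : F, x ^ i * ∏ u ∈ U, (x - u.1) from rfl,
      moment_sum_pow] at h3
    simp only [eval_mul, eval_pow, eval_X] at h3
    rw [h3]
    refine Finset.sum_congr rfl fun l hl => ?_
    rw [Finset.mem_range] at hl
    rw [coeff_atInfinity _ (by omega)]
    rfl
  rw [h1]
  by_cases hz : U.card + μ + j < Fintype.card F - 1
  · refine Finset.sum_eq_zero fun l hl => ?_
    rw [Finset.mem_range] at hl
    rw [redeiMomentInfinity_eq_zero U (by omega), mul_zero]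
  have h2 := congrArg (fun p => p.coeff (U.card + μ + j - (Fintype.card F - 1))) h
  rw [moment_mul_X_pow _ hn, finsetSum_coeff, coeff_zero] at h2
  rw [← h2]
  refine Finset.sum_congr rfl fun l hl => ?_
  rw [Finset.mem_range] at hl
  by_cases hl' : U.card + (l + j) < Fintype.card F - 1
  · rw [redeiMomentInfinity_eq_zero U hl', mul_zero]
    have h3 : redeiMoment U (l + j) = 0 := by
      by_contra h0
      have := (redeiMoment_degLE U (l + j)).natDegree_le h0
      push_cast at this
      omega
    rw [h3, mul_zero, coeff_zero]
  · rw [show U.card + μ + j - (Fintype.card F - 1) =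
      (μ - l) + (U.card + (l + j) - (Fintype.card F - 1)) by omega,
      coeff_mul_add_eq_of_natDegree_le, coeff_redeiMoment U (by omega)]
    · by_cases h0 : Q.coeff l = 0
      · simp [h0]
      · have := (hμ l).natDegree_le h0
        omega
    · by_cases h0 : redeiMoment U (l + j) = 0
      · simp [h0]
      · have := (redeiMoment_degLE U (l + j)).natDegree_le h0
        push_cast at this
        omega

end Redei

/-! ### Envelopes containing the missing lines. -/

section Envelope

variable {F : Type*} [Field F] [Fintype F]

open Classical in
/-- The values `x` such that the line `a * y - b = x` of direction `y` misses `U`. -/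
noncomputable def missing (U : Finset (F × F)) (y : F) : Finset F :=
  Finset.univ.filter fun x => ∀ u ∈ U, x ≠ u.1 * y - u.2

open Classical in
/-- The values `x` such that the line `a = x` misses `U`. -/
noncomputable def missingAtInfinity (U : Finset (F × F)) : Finset F :=
  Finset.univ.filter fun x => ∀ u ∈ U, x ≠ u.1

theorem eval_redei_ne_zero_iff {U : Finset (F × F)} {x y : F} :
    ((redei U).eval (C x)).eval y ≠ 0 ↔ x ∈ missing U y := by
  rw [eval_redei, Finset.prod_ne_zero_iff]
  simp [missing, sub_ne_zero]

theorem prod_ne_zero_iff_mem_missingAtInfinity {U : Finset (F × F)} {x : F} :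
    ∏ u ∈ U, (x - u.1) ≠ 0 ↔ x ∈ missingAtInfinity U := by
  rw [Finset.prod_ne_zero_iff]
  simp [missingAtInfinity, sub_ne_zero]

theorem moment_redei (U : Finset (F × F)) (P : F[X][X]) :
    moment (redeiMoment U) P = ∑ x : F, P.eval (C x) * (redei U).eval (C x) :=
  moment_sum_pow _ (fun x : F => C x) _ P

theorem eval_eq_zero_of_mem_missing {U : Finset (F × F)} {Q : F[X][X]} {M : ℕ}
    (hQ : ∀ j < M, moment (redeiMoment U) (Q * X ^ j) = 0) {y : F} (hy : (missing U y).card ≤ M)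
    {x : F} (hx : x ∈ missing U y) : (Q.eval (C x)).eval y = 0 := by
  have key : ∀ x : F, (Q.map (evalRingHom y)).eval x = (Q.eval (C x)).eval y := by
    intro x
    rw [eval_map, ← coe_evalRingHom y, ← eval₂_id (p := Q), hom_eval₂]
    simp
  rw [← key]
  refine eval_eq_zero_of_sum_eq_zero (w := fun x => ((redei U).eval (C x)).eval y)
    (fun z hz => eval_redei_ne_zero_iff.mp hz) hy (fun j hj => ?_) (eval_redei_ne_zero_iff.mpr hx)
  have h1 := congrArg (eval y) (hQ j hj)
  rw [moment_redei, eval_finsetSum, eval_zero] at h1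
  rw [← h1]
  refine Finset.sum_congr rfl fun z _ => ?_
  rw [key]
  simp

theorem eval_atInfinity_eq_zero {U : Finset (F × F)} {Q : F[X][X]} {M μ n : ℕ} (hμ : TotLE Q μ)
    (hn : Q.natDegree ≤ n) (hnμ : n ≤ μ)
    (hQ : ∀ j < M, moment (redeiMoment U) (Q * X ^ j) = 0)
    (hM : U.card + n + M ≤ 2 * (Fintype.card F - 1))
    (hU : (missingAtInfinity U).card ≤ M) {x : F} (hx : x ∈ missingAtInfinity U) :
    (atInfinity μ Q).eval x = 0 :=
  eval_eq_zero_of_sum_eq_zero (w := fun x => ∏ u ∈ U, (x - u.1))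
    (fun _ hz => prod_ne_zero_iff_mem_missingAtInfinity.mp hz) hU
    (fun j hj => sum_atInfinity_eq_zero U hμ hn hnμ (by omega) (hQ j hj))
    (prod_ne_zero_iff_mem_missingAtInfinity.mpr hx)

theorem vanishAt_redeiMoment {U : Finset (F × F)} {K : Finset F} {t : ℕ}
    (hK : ∀ y ∈ K, (missing U y).card = t) : VanishAt (redeiMoment U) K t := by
  intro y hy
  refine ⟨∏ x ∈ missing U y, (X - C (C x)), monic_prod_of_monic _ _ fun _ _ => monic_X_sub_C _,
    ?_, fun j => ?_⟩
  · rw [natDegree_prod_of_monic _ _ fun _ _ => monic_X_sub_C _, ← hK y hy]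
    simp only [natDegree_X_sub_C, Finset.sum_const, smul_eq_mul, mul_one]
  · rw [dvd_iff_isRoot, IsRoot.def, moment_redei, eval_finsetSum]
    refine Finset.sum_eq_zero fun x _ => ?_
    by_cases hx : x ∈ missing U y
    · rw [eval_mul, eval_mul, eval_prod, Finset.prod_eq_zero hx (by simp)]
      simp
    · rw [eval_mul, not_not.mp (mt eval_redei_ne_zero_iff.mp hx), mul_zero]

/-- At `y` the weight has exactly $t$ support points; a kernel vector would be a nonzero polynomial
of degree less than $t$ vanishing at all of them. -/
theorem det_hankel_redei_ne_zero {U : Finset (F × F)} {y : F} {t : ℕ}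
    (hy : (missing U y).card = t) : (hankel (redeiMoment U) 1 t).det ≠ 0 := by
  intro h0
  have h1 := det_hankel_map (evalRingHom y) (redeiMoment U) 1 t
  rw [h0, map_zero, Polynomial.map_one] at h1
  obtain ⟨f, hf0, hfd, hf⟩ := exists_orthogonal_of_det_eq_zero h1
  have h2 : (fun i => evalRingHom y (redeiMoment U i)) =
      fun i => ∑ x : F, x ^ i * ((redei U).eval (C x)).eval y := by
    funext i
    simp [redeiMoment]
  rw [h2] at hf
  refine hf0 (eq_zero_of_natDegree_lt_card_of_eval_eq_zero' f (missing U y) (fun x hx => ?_) ?_)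
  · refine eval_eq_zero_of_sum_eq_zero (w := fun x => ((redei U).eval (C x)).eval y)
      (fun z hz => eval_redei_ne_zero_iff.mp hz) hy.le (fun j hj => ?_)
      (eval_redei_ne_zero_iff.mpr hx)
    have h3 := hf j hj
    rw [moment_sum_pow] at h3
    simpa using h3
  · rw [hy]
    exact (natDegree_lt_iff_degree_lt hf0).mpr hfd

/-- The missed lines of the directions of small index lie on an envelope of class `t`. -/
theorem exists_envelope {U : Finset (F × F)} {K : Finset F} {t ε : ℕ} (ht : 1 ≤ t)
    (hU : U.card + t = Fintype.card F + ε) (hK : ∀ y ∈ K, (missing U y).card = t)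
    (hKε : (t + 1) * (ε + 1) < K.card) (htq : t + 3 ≤ Fintype.card F) :
    ∃ Q : F[X][X], Q.natDegree = t ∧ TotLE Q t ∧ (∃ a : F, a ≠ 0 ∧ Q.coeff t = C a) ∧
      (∀ y, (missing U y).card ≤ t + 1 → ∀ x ∈ missing U y, (Q.eval (C x)).eval y = 0) ∧
      ((missingAtInfinity U).card ≤ t + 1 →
        ∀ x ∈ missingAtInfinity U, (atInfinity t Q).eval x = 0) := by
  have hKq : K.card ≤ Fintype.card F := Finset.card_le_univ K
  obtain ⟨y₀, hy₀⟩ : K.Nonempty := Finset.card_pos.mp (by omega)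
  have hdet := det_hankel_redei_ne_zero (hK y₀ hy₀)
  have hv := vanishAt_redeiMoment hK
  have hc := redeiMoment_degLE U
  have he : (U.card : ℤ) + 1 - Fintype.card F = ε + 1 - t := by omega
  rw [he] at hc
  -- For $m = t+j+1$ and $|K| \ge (t+1)(\varepsilon+1)+1$, the divisor degree exceeds the
  -- determinant bound by at least $j(t\varepsilon - j) + 1$, whence the range of $m$.
  have hdet0 : ∀ m, t < m → m ≤ t + t * ε + 1 → (hankel (redeiMoment U) 1 m).det = 0 := by
    intro m hm1 hm2
    refine hv.det_eq_zero hc ?_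
    obtain ⟨j, rfl⟩ := Nat.exists_eq_add_of_lt hm1
    have hj : j ≤ t * ε := by omega
    rw [show t + j + 1 - t = j + 1 by omega]
    have h1 : (((t + 1) * (ε + 1) + 1 : ℕ) : ℤ) * (j + 1) ≤ K.card * (j + 1) :=
      mul_le_mul_of_nonneg_right (by exact_mod_cast hKε) (by omega)
    have h2 : (0 : ℤ) ≤ j * (t * ε - j) := mul_nonneg (by omega) (by
      have : (j : ℤ) ≤ t * ε := by exact_mod_cast hj
      omega)
    push_cast at h1 ⊢
    nlinarith
  obtain ⟨Q, hQp, hQn, hQ⟩ := exists_isPrimitive_orthogonal (by omega) hdet hdet0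
  have htot : TotLE Q t := by
    -- For $n = t$ there is no nodal factor; the excess $t\varepsilon$ is less than the number
    -- $t\varepsilon + 2$ of twists.
    refine totLE_of_orthogonal (s := 0) hv hc hQp (by omega) (by omega) hQn hQ hdet ?_
    rw [Nat.sub_self, show t + t * ε + 1 - t + 1 = t * ε + 2 by omega]
    push_cast
    nlinarith
  refine ⟨Q, hQn, htot, ⟨(Q.coeff t).coeff 0, ?_, ?_⟩, fun y hy x hx => ?_, fun hy x hx => ?_⟩
  · intro h
    have h1 : Q.coeff t = 0 := by
      rw [eq_C_of_natDegree_le_zero ((htot.natDegree_coeff_le t).trans (by omega)), h, C_0]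
    rw [← hQn, coeff_natDegree, leadingCoeff_eq_zero] at h1
    exact hQp.ne_zero h1
  · exact eq_C_of_natDegree_le_zero ((htot.natDegree_coeff_le t).trans (by omega))
  · exact eval_eq_zero_of_mem_missing (M := t + 1) (fun j hj => hQ j (by omega)) hy hx
  · refine eval_atInfinity_eq_zero (M := t + 1) htot hQn.le le_rfl (fun j hj => hQ j (by omega))
      ?_ hy hx
    -- The room needed at infinity is $\varepsilon + t + 3 \le q$; for positive $\varepsilon$ it
    -- follows from the lower bound on $|K| \le q$.
    rcases Nat.eq_zero_or_pos ε with rfl | hε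
    · omega
    · have : 1 ≤ t * ε := Nat.mul_pos ht hε
      rw [Nat.add_mul, Nat.mul_add] at hKε
      omega

/-- The missed lines of the directions of small index lie on an envelope of class two. -/
theorem exists_conic_envelope {U : Finset (F × F)} {K : Finset F} {ε : ℕ}
    (hU : U.card + 1 = Fintype.card F + ε) (hK : ∀ y ∈ K, (missing U y).card = 1)
    (hKε : 3 * (ε + 2) < 2 * K.card) (hq : 4 ≤ Fintype.card F) :
    ∃ Q : F[X][X], Q ≠ 0 ∧ TotLE Q 2 ∧
      (∀ y, (missing U y).card ≤ 2 → ∀ x ∈ missing U y, (Q.eval (C x)).eval y = 0) ∧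
      (K.card < Fintype.card F → (missingAtInfinity U).card ≤ 2 →
        ∀ x ∈ missingAtInfinity U, (atInfinity 2 Q).eval x = 0) := by
  obtain ⟨y₀, hy₀⟩ : K.Nonempty := Finset.card_pos.mp (by omega)
  have hdet := det_hankel_redei_ne_zero (hK y₀ hy₀)
  have hv := vanishAt_redeiMoment hK
  have hc := redeiMoment_degLE U
  have he : (U.card : ℤ) + 1 - Fintype.card F = ε := by omega
  rw [he] at hc
  -- For $m = j+3$, twice the difference of the degrees is at least $j(\varepsilon - 3 - 2j) + 2$.
  -- The subtraction is truncated, so for $\varepsilon < 3$ only $m = 3$ remains.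
  have hdet0 : ∀ m, 2 < m → m ≤ 3 + (ε - 3) / 2 → (hankel (redeiMoment U) 1 m).det = 0 := by
    intro m hm1 hm2
    refine hv.det_eq_zero hc ?_
    obtain ⟨j, rfl⟩ := Nat.exists_eq_add_of_lt hm1
    rw [show 2 + j + 1 - 1 = j + 2 by omega]
    have h1 : ((3 * (ε + 2) + 1 : ℕ) : ℤ) * (j + 2) ≤ (2 * K.card : ℕ) * (j + 2) :=
      mul_le_mul_of_nonneg_right (by exact_mod_cast hKε) (by omega)
    have h2 : (0 : ℤ) ≤ j * (ε - 3 - 2 * j) := by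
      rcases Nat.eq_zero_or_pos j with rfl | hj
      · simp
      · exact mul_nonneg (by omega) (by omega)
    push_cast at h1 ⊢
    nlinarith
  -- If the second determinant vanishes, `Q` has degree 1 in $X$ and total degree at most $1 + 1$;
  -- otherwise it has degree 2 in $X$ and total degree at most $2 + 0$.
  obtain ⟨n, hn1, hn2, hQ⟩ : ∃ n, n ≠ 0 ∧ n ≤ 2 ∧ ∃ Q : F[X][X], Q ≠ 0 ∧ Q.natDegree = n ∧
      TotLE Q 2 ∧ ∀ j < 3 + (ε - 3) / 2, moment (redeiMoment U) (Q * X ^ j) = 0 := by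
    by_cases h2 : (hankel (redeiMoment U) 1 2).det = 0
    · obtain ⟨Q, hQp, hQn, hQ⟩ := exists_isPrimitive_orthogonal (M := 3 + (ε - 3) / 2) (by omega)
        hdet (fun m hm1 hm2 => by
          rcases (show 2 ≤ m from hm1).eq_or_lt with rfl | hm
          · exact h2
          · exact hdet0 m hm hm2)
      refine ⟨1, one_ne_zero, by omega, Q, hQp.ne_zero, hQn, ?_, hQ⟩
      refine totLE_of_orthogonal (s := 1) hv hc hQp one_ne_zero (by omega) hQn hQ hdet ?_
      push_cast
      omega
    · obtain ⟨Q, hQp, hQn, hQ⟩ := exists_isPrimitive_orthogonal (M := 3 + (ε - 3) / 2) (by omega)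
        h2 hdet0
      refine ⟨2, two_ne_zero, le_rfl, Q, hQp.ne_zero, hQn, ?_, hQ⟩
      refine totLE_of_orthogonal (s := 0) hv hc hQp two_ne_zero (by omega) hQn hQ h2 ?_
      push_cast
      omega
  obtain ⟨Q, hQ0, hQn, htot, hQ⟩ := hQ
  refine ⟨Q, hQ0, htot, fun y hy x hx => ?_, fun hKq hy x hx => ?_⟩
  · exact eval_eq_zero_of_mem_missing (M := 2) (fun j hj => hQ j (by omega)) hy hx
  -- The room needed is at most $\varepsilon + 5 \le q$, which $|K| < q$ supplies; it fails for $|K|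
  -- = q = 4$, $\varepsilon = 0$.
  · exact eval_atInfinity_eq_zero (M := 2) htot hQn.le hn2 (fun j hj => hQ j (by omega))
      (by omega) hy hx

end Envelope

/-! ### Splitting an envelope into pencils. -/

section Splitting

variable {F : Type*} [Field F]

theorem eval_eval_eq (Q : F[X][X]) (l : F[X]) (y : F) :
    (Q.eval l).eval y = (Q.eval (C (l.eval y))).eval y := by
  have key : ∀ l : F[X], (Q.eval l).eval y = (Q.map (evalRingHom y)).eval (l.eval y) := by
    intro l
    rw [eval_map, ← coe_evalRingHom y, ← eval₂_id (p := Q), hom_eval₂]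
    simp
  rw [key, key, eval_C]

theorem TotLE.degLE_eval {Q : F[X][X]} {d : ℤ} (hQ : TotLE Q d) {l : F[X]} (hl : DegLE l 1) :
    DegLE (Q.eval l) d := by
  rw [eval_eq_sum_range]
  refine DegLE.sum fun j _ => ?_
  have h : DegLE (l ^ j) j := by
    have := DegLE.prod (s := Finset.range j) (f := fun _ => l) (d := fun _ => 1) fun _ _ => hl
    simpa using this
  exact ((hQ j).mul h).mono (by omega)

/-- Descending induction on the index, by $P_j = ((X-l)P)_{j+1} + l P_{j+1}$. -/
theorem TotLE.of_line_mul {P : F[X][X]} {l : F[X]} (hl : DegLE l 1) {d : ℤ}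
    (h : TotLE ((Polynomial.X - Polynomial.C l) * P) (d + 1)) : TotLE P d := by
  have key : ∀ m j : ℕ, P.natDegree < j + m → DegLE (P.coeff j) (d - j) := by
    intro m
    induction m with
    | zero =>
      intro j hj
      rw [coeff_eq_zero_of_natDegree_lt (n := j) hj]
      exact DegLE.zero _
    | succ m ih =>
      intro j hj
      have h1 : P.coeff j = ((Polynomial.X - Polynomial.C l) * P).coeff (j + 1) + l * P.coeff (j + 1) := by
        rw [sub_mul, coeff_sub, coeff_X_mul, coeff_C_mul]
        ring
      rw [h1]
      exact ((h (j + 1)).mono (by push_cast; omega)).add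
        ((hl.mul (ih (j + 1) (by omega))).mono (by push_cast; omega))
  exact fun j => key (P.natDegree + 1) j (by omega)

open Classical in
/-- The points of ordinate `y` on the curve `Q`. -/
noncomputable def zerosAt [Fintype F] (Q : F[X][X]) (y : F) : Finset F :=
  Finset.univ.filter fun x => (Q.eval (C x)).eval y = 0

theorem mem_zerosAt [Fintype F] {Q : F[X][X]} {x y : F} :
    x ∈ zerosAt Q y ↔ (Q.eval (C x)).eval y = 0 := by
  simp [zerosAt]

/-- Join a fixed zero $(x_0, y_0)$ to the at least $(|K|-1)(s+1)$ zeros over the other elements of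
`K`. One of the $q$ slopes occurs more than $s$ times, so that line carries at least $s+2$ zeros of
a curve of degree $s+1$ and is a component. -/
theorem exists_line_dvd [Fintype F] {Q : F[X][X]} {s : ℕ} (hQ : TotLE Q (s + 1 : ℕ))
    {K : Finset F} (hK : ∀ y ∈ K, s + 1 ≤ (zerosAt Q y).card)
    (hs : Fintype.card F * s < (K.card - 1) * (s + 1)) :
    ∃ a b : F, X - C (C a * X - C b) ∣ Q := by
  classical
  obtain ⟨y₀, hy₀⟩ : K.Nonempty := by
    rw [← Finset.card_pos]
    by_contra h
    rw [show K.card - 1 = 0 by omega, zero_mul] at hs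
    omega
  obtain ⟨x₀, hx₀⟩ : (zerosAt Q y₀).Nonempty :=
    Finset.card_pos.mp (lt_of_lt_of_le (Nat.succ_pos s) (hK y₀ hy₀))
  set W := (K.erase y₀).sigma fun y => zerosAt Q y with hW
  have hWc : Fintype.card F * s < W.card := by
    refine lt_of_lt_of_le hs ?_
    rw [hW, Finset.card_sigma, ← Finset.card_erase_of_mem hy₀, ← smul_eq_mul]
    exact Finset.card_nsmul_le_sum _ _ _ fun y hy => hK y (Finset.mem_of_mem_erase hy)
  obtain ⟨a, -, ha⟩ := Finset.exists_lt_card_fiber_of_mul_lt_card_of_maps_to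
    (f := fun p : (_ : F) × F => (p.2 - x₀) / (p.1 - y₀)) (t := Finset.univ)
    (fun _ _ => Finset.mem_univ _) (by rw [Finset.card_univ]; exact hWc)
  set T := W.filter fun p => (p.2 - x₀) / (p.1 - y₀) = a with hT
  have hTm : ∀ p ∈ T, p.1 ∈ K ∧ p.1 ≠ y₀ ∧ p.2 ∈ zerosAt Q p.1 ∧
      p.2 = a * p.1 - (a * y₀ - x₀) := by
    intro p hp
    rw [hT, Finset.mem_filter, hW, Finset.mem_sigma, Finset.mem_erase] at hp
    obtain ⟨⟨⟨h1, h2⟩, h3⟩, h4⟩ := hp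
    refine ⟨h2, h1, h3, ?_⟩
    rw [div_eq_iff (sub_ne_zero.mpr h1)] at h4
    linear_combination h4
  refine ⟨a, a * y₀ - x₀, ?_⟩
  rw [dvd_iff_isRoot, IsRoot.def]
  set l : F[X] := C a * X - C (a * y₀ - x₀) with hl
  have hlev : ∀ y, l.eval y = a * y - (a * y₀ - x₀) := fun y => by simp [hl]
  have hdeg : DegLE (Q.eval l) (s + 1 : ℕ) := hQ.degLE_eval (degLE_line a (a * y₀ - x₀))
  by_contra h0
  have h1 := hdeg.natDegree_le h0
  refine h0 (eq_zero_of_natDegree_lt_card_of_eval_eq_zero' _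
    (insert y₀ (T.image fun p => p.1)) (fun y hy => ?_) ?_)
  · rw [eval_eval_eq, hlev, ← mem_zerosAt]
    rcases Finset.mem_insert.mp hy with rfl | hy
    · simpa using hx₀
    · obtain ⟨p, hp, rfl⟩ := Finset.mem_image.mp hy
      obtain ⟨-, -, h3, h4⟩ := hTm p hp
      rwa [← h4]
  · rw [Finset.card_insert_of_notMem, Finset.card_image_of_injOn]
    · omega
    · intro p hp p' hp' hpp
      have e1 := (hTm p hp).2.2.2
      have e2 := (hTm p' hp').2.2.2
      refine Sigma.ext hpp (heq_of_eq ?_)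
      rw [e1, e2]
      simp only at hpp
      rw [hpp]
    · intro hy
      obtain ⟨p, hp, hpy⟩ := Finset.mem_image.mp hy
      exact (hTm p hp).2.1 hpy

/-- An envelope of class `s` with many lines splits into `s` pencils. -/
theorem exists_carriers [Fintype F] {K : Finset F} {t : ℕ}
    (ht : Fintype.card F * (t - 1) < (K.card - 1) * t) (s : ℕ) (hst : s ≤ t) {Q : F[X][X]}
    (hQ : TotLE Q s) {a : F} (ha : a ≠ 0) (hQa : Q.coeff s = C a)
    (hK : ∀ y ∈ K, s ≤ (zerosAt Q y).card) :
    ∃ V : Finset (F × F), V.card ≤ s ∧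
      (∀ x y, (Q.eval (C x)).eval y = 0 → ∃ u ∈ V, x = u.1 * y - u.2) ∧
      ∀ x, (atInfinity s Q).eval x = 0 → ∃ u ∈ V, x = u.1 := by
  classical
  induction s generalizing Q with
  | zero =>
    have hQC : Q = C (C a) := by
      rw [← hQa]
      refine eq_C_of_natDegree_le_zero (natDegree_le_iff_coeff_eq_zero.mpr fun j hj => ?_)
      exact hQ.coeff_eq_zero (by exact_mod_cast hj)
    refine ⟨∅, by simp, fun x y h => ?_, fun x h => ?_⟩
    · simp [hQC, ha] at h
    · simp [atInfinity, hQC, ha] at h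
  | succ s ih =>
    -- The pigeonhole condition is inherited by smaller classes because $s/(s+1) \le (t-1)/t$ for $s
    -- + 1 \le t$.
    have hs : Fintype.card F * s < (K.card - 1) * (s + 1) := by
      obtain ⟨t, rfl⟩ := Nat.exists_eq_succ_of_ne_zero (show t ≠ 0 by omega)
      simp only [Nat.succ_eq_add_one, Nat.add_sub_cancel] at ht
      have h1 : s * (t + 1) ≤ t * (s + 1) := by nlinarith
      have h2 : Fintype.card F * s * (t + 1) < (K.card - 1) * (s + 1) * (t + 1) :=
        calc Fintype.card F * s * (t + 1) = Fintype.card F * (s * (t + 1)) := by ring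
          _ ≤ Fintype.card F * (t * (s + 1)) := Nat.mul_le_mul_left _ h1
          _ = Fintype.card F * t * (s + 1) := by ring
          _ < (K.card - 1) * (t + 1) * (s + 1) := Nat.mul_lt_mul_of_pos_right ht (Nat.succ_pos s)
          _ = _ := by ring
      exact lt_of_mul_lt_mul_right h2 (Nat.zero_le _)
    obtain ⟨α, β, P, rfl⟩ := exists_line_dvd hQ hK hs
    have hP : TotLE P s := by
      refine TotLE.of_line_mul (degLE_line α β) ?_
      exact_mod_cast hQ
    have hPa : P.coeff s = C a := by
      rw [← hQa, sub_mul, coeff_sub, coeff_X_mul, coeff_C_mul, hP.coeff_eq_zero (j := s + 1)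
        (by push_cast; omega), mul_zero, sub_zero]
    have hfac : ∀ x y, (((X - C (C α * X - C β)) * P).eval (C x)).eval y =
        (x - (α * y - β)) * (P.eval (C x)).eval y := by
      intro x y
      simp
    obtain ⟨V, hVc, hV1, hV2⟩ := ih (by omega) hP hPa fun y hy => by
      have h1 : zerosAt ((X - C (C α * X - C β)) * P) y ⊆
          insert (α * y - β) (zerosAt P y) := by
        intro x hx
        rw [mem_zerosAt, hfac, mul_eq_zero, sub_eq_zero] at hx
        rw [Finset.mem_insert, mem_zerosAt]
        exact hx
      have h2 := (Finset.card_le_card h1).trans (Finset.card_insert_le _ _)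
      have := hK y hy
      omega
    refine ⟨insert (α, β) V, (Finset.card_insert_le _ _).trans (by omega), fun x y h => ?_,
      fun x h => ?_⟩
    · rw [hfac, mul_eq_zero, sub_eq_zero] at h
      rcases h with h | h
      · exact ⟨(α, β), Finset.mem_insert_self _ _, h⟩
      · obtain ⟨u, hu, hux⟩ := hV1 x y h
        exact ⟨u, Finset.mem_insert_of_mem hu, hux⟩
    · rw [atInfinity_line_mul hP, eval_mul, mul_eq_zero] at h
      rcases h with h | h
      · refine ⟨(α, β), Finset.mem_insert_self _ _, ?_⟩
        simpa [sub_eq_zero] using h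
      · obtain ⟨u, hu, hux⟩ := hV2 x h
        exact ⟨u, Finset.mem_insert_of_mem hu, hux⟩

/-- The missed lines of the directions of small index belong to `t` affine pencils. -/
theorem exists_carriers_of_missing [Fintype F] {U : Finset (F × F)} {K : Finset F} {t ε : ℕ}
    (ht : 1 ≤ t) (hU : U.card + t = Fintype.card F + ε) (hK : ∀ y ∈ K, (missing U y).card = t)
    (hKε : (t + 1) * (ε + 1) < K.card) (htq : t + 3 ≤ Fintype.card F)
    (hKt : Fintype.card F * (t - 1) < (K.card - 1) * t) :
    ∃ V : Finset (F × F), V.card ≤ t ∧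
      (∀ y, (missing U y).card ≤ t + 1 →
        (missing U y).card ≤ t ∧ ∀ x ∈ missing U y, ∃ u ∈ V, x = u.1 * y - u.2) ∧
      ((missingAtInfinity U).card ≤ t + 1 →
        (missingAtInfinity U).card ≤ t ∧ ∀ x ∈ missingAtInfinity U, ∃ u ∈ V, x = u.1) := by
  classical
  obtain ⟨Q, -, hQ, ⟨a, ha, hQa⟩, h1, h2⟩ := exists_envelope ht hU hK hKε htq
  obtain ⟨V, hVc, hV1, hV2⟩ := exists_carriers hKt t le_rfl hQ ha hQa fun y hy => by
    rw [← hK y hy]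
    exact Finset.card_le_card fun x hx => mem_zerosAt.mpr (h1 y (by rw [hK y hy]; omega) x hx)
  refine ⟨V, hVc, fun y hy => ?_, fun hy => ?_⟩
  · have h3 : ∀ x ∈ missing U y, ∃ u ∈ V, x = u.1 * y - u.2 := fun x hx => hV1 x y (h1 y hy x hx)
    refine ⟨?_, h3⟩
    -- Each carrier accounts for one line of slope `y`, so an index of $t+1$ cannot occur.
    refine (Finset.card_le_card (t := V.image fun u => u.1 * y - u.2) fun x hx => ?_).trans
      (Finset.card_image_le.trans hVc)
    obtain ⟨u, hu, rfl⟩ := h3 x hx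
    exact Finset.mem_image_of_mem _ hu
  · have h3 : ∀ x ∈ missingAtInfinity U, ∃ u ∈ V, x = u.1 := fun x hx => hV2 x (h2 hy x hx)
    refine ⟨?_, h3⟩
    refine (Finset.card_le_card (t := V.image fun u => u.1) fun x hx => ?_).trans
      (Finset.card_image_le.trans hVc)
    obtain ⟨u, hu, rfl⟩ := h3 x hx
    exact Finset.mem_image_of_mem _ hu

end Splitting

end MomentFunctional

/-- A quadratic form with three pairwise independent isotropic vectors in the kernel of a linear
form is divisible by this linear form. -/
theorem QuadraticForm.exists_eq_mul_of_isotropic {F V : Type*} [Field F] [AddCommGroup V]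
    [Module F V] (φ : QuadraticForm F V) {g : V →ₗ[F] F} (hg : g ≠ 0) {u v : V} {a b : F}
    (hker : ∀ x, g x = 0 → ∃ c d : F, x = c • u + d • v) (ha : a ≠ 0) (hb : b ≠ 0)
    (hu : φ u = 0) (hv : φ v = 0) (huv : φ (a • u + b • v) = 0) :
    ∃ g' : V →ₗ[F] F, ∀ x, φ x = g x * g' x := by
  have hlin : ∀ c d : F, φ (c • u + d • v) = c * d * QuadraticMap.polar φ u v := by
    intro c d
    rw [QuadraticMap.map_add φ, QuadraticMap.map_smul, QuadraticMap.map_smul, hu, hv,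
      QuadraticMap.polar_smul_left, QuadraticMap.polar_smul_right]
    simp [mul_assoc]
  rw [hlin] at huv
  have hp : QuadraticMap.polar φ u v = 0 :=
    (mul_eq_zero.mp huv).resolve_left (mul_ne_zero ha hb)
  obtain ⟨z, hz⟩ : ∃ z, g z ≠ 0 := by
    by_contra! h
    exact hg (LinearMap.ext h)
  obtain ⟨z, hz⟩ : ∃ z, g z = 1 := ⟨(g z)⁻¹ • z, by simp [hz]⟩
  -- The form vanishes on $\ker g$; the cofactor is read off from the expansion of $\varphi(g(x)z +
  -- w)$ with $w = x - g(x)z \in \ker g$.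
  refine ⟨(φ z - QuadraticMap.polar φ z z) • g + φ.polarBilin z, fun x => ?_⟩
  obtain ⟨c, d, hcd⟩ := hker (x - g x • z) (by simp [hz])
  have h0 : φ (x - g x • z) = 0 := by rw [hcd, hlin, hp, mul_zero]
  have h1 : x = g x • z + (x - g x • z) := by abel
  conv_lhs => rw [h1, QuadraticMap.map_add φ, h0, QuadraticMap.map_smul,
    QuadraticMap.polar_smul_left, QuadraticMap.polar_sub_right, QuadraticMap.polar_smul_right]
  simp
  ring

namespace PG2

open Polynomial Matrix MomentFunctional

/-! ### Projective frames with a prescribed line at infinity. -/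

section Coordinates

variable {F : Type*} [Field F]

theorem vecMul_ne_zero (B : (Matrix (Fin 3) (Fin 3) F)ˣ) {c : Fin 3 → F} (hc : c ≠ 0) :
    c ᵥ* B.val ≠ 0 := by
  intro h
  refine hc ?_
  have := congrArg (fun v => v ᵥ* B⁻¹.val) h
  simpa [vecMul_vecMul] using this

theorem mulVec_ne_zero (B : (Matrix (Fin 3) (Fin 3) F)ˣ) {d : Fin 3 → F} (hd : d ≠ 0) :
    B.val *ᵥ d ≠ 0 := by
  intro h
  refine hd ?_
  have := congrArg (fun v => B⁻¹.val *ᵥ v) h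
  simpa [mulVec_mulVec] using this

/-- The point with coordinates `c` in the frame given by the rows of `B`. -/
def point (B : (Matrix (Fin 3) (Fin 3) F)ˣ) (c : Fin 3 → F) (hc : c ≠ 0) : Point F :=
  Projectivization.mk F (c ᵥ* B.val) (vecMul_ne_zero B hc)

/-- The line with coordinates `d` in the frame given by the rows of `B`. -/
def line (B : (Matrix (Fin 3) (Fin 3) F)ˣ) (d : Fin 3 → F) (hd : d ≠ 0) : Line F :=
  Projectivization.mk F (B⁻¹.val *ᵥ d)
    (mulVec_ne_zero B⁻¹ hd)

variable (B : (Matrix (Fin 3) (Fin 3) F)ˣ) {c c' d d' : Fin 3 → F}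

/-- Lines are transformed by the inverse matrix so that incidence stays the plain dot product. -/
theorem point_mem_line (hc : c ≠ 0) (hd : d ≠ 0) : point B c hc ∈ line B d hd ↔ c ⬝ᵥ d = 0 := by
  rw [Configuration.ofField.mem_iff, point, line, Projectivization.orthogonal_mk,
    dotProduct_mulVec, vecMul_vecMul, Units.mul_inv, vecMul_one]

theorem exists_eq_point (P : Point F) : ∃ c hc, P = point B c hc := by
  refine ⟨P.rep ᵥ* B⁻¹.val,
    vecMul_ne_zero B⁻¹ P.rep_nonzero, ?_⟩
  conv_lhs => rw [← P.mk_rep]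
  simp only [point, vecMul_vecMul, Units.inv_mul, vecMul_one]

theorem exists_eq_line (r : Line F) : ∃ d hd, r = line B d hd := by
  refine ⟨B.val *ᵥ r.rep, mulVec_ne_zero B r.rep_nonzero, ?_⟩
  conv_lhs => rw [← r.mk_rep]
  simp only [line, mulVec_mulVec, Units.inv_mul, one_mulVec]

theorem point_eq_point (hc : c ≠ 0) (hc' : c' ≠ 0) :
    point B c hc = point B c' hc' ↔ ∃ a : F, a • c' = c := by
  rw [point, point, Projectivization.mk_eq_mk_iff']
  refine exists_congr fun a => ⟨fun h => ?_, fun h => by rw [← h, smul_vecMul]⟩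
  have := congrArg (fun v => v ᵥ* B⁻¹.val) h
  simpa [vecMul_vecMul, smul_vecMul] using this

theorem line_eq_line (hd : d ≠ 0) (hd' : d' ≠ 0) :
    line B d hd = line B d' hd' ↔ ∃ a : F, a • d' = d := by
  rw [line, line, Projectivization.mk_eq_mk_iff']
  refine exists_congr fun a => ⟨fun h => ?_, fun h => by rw [← h, mulVec_smul]⟩
  have := congrArg (fun v => B.val *ᵥ v) h
  simpa [mulVec_mulVec, mulVec_smul] using this

/-- The line at infinity. -/
def lineAtInfinity : Line F := line B ![0, 0, 1] (by simp)

/-- The point at infinity of slope `y`. -/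
def direction (y : F) : Point F := point B ![1, y, 0] (by simp)

/-- The point at infinity of infinite slope. -/
def vertical : Point F := point B ![0, 1, 0] (by simp)

/-- The affine point with coordinates `u`. -/
def affine (u : F × F) : Point F := point B ![u.1, u.2, 1] (by simp)

/-- The affine line `a * y - b = x` of slope `y`. -/
def slopeLine (y x : F) : Line F := line B ![-y, 1, x] (by simp)

/-- The affine line `a = x`. -/
def verticalLine (x : F) : Line F := line B ![-1, 0, x] (by simp)

theorem direction_mem (y : F) : direction B y ∈ lineAtInfinity B := by
  simp [direction, lineAtInfinity, point_mem_line, dotProduct, Fin.sum_univ_three]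

theorem vertical_mem : vertical B ∈ lineAtInfinity B := by
  simp [vertical, lineAtInfinity, point_mem_line, dotProduct, Fin.sum_univ_three]

theorem affine_notMem (u : F × F) : affine B u ∉ lineAtInfinity B := by
  simp [affine, lineAtInfinity, point_mem_line, dotProduct, Fin.sum_univ_three]

theorem direction_mem_slopeLine (y x : F) : direction B y ∈ slopeLine B y x := by
  simp [direction, slopeLine, point_mem_line, dotProduct, Fin.sum_univ_three]

theorem vertical_mem_verticalLine (x : F) : vertical B ∈ verticalLine B x := by
  simp [vertical, verticalLine, point_mem_line, dotProduct, Fin.sum_univ_three]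

theorem affine_mem_slopeLine {u : F × F} {y x : F} :
    affine B u ∈ slopeLine B y x ↔ x = u.1 * y - u.2 := by
  simp only [affine, slopeLine, point_mem_line, dotProduct, Fin.sum_univ_three, cons_val_zero,
    cons_val_one, cons_val, mul_neg, mul_one, one_mul]
  constructor <;> intro h <;> linear_combination h

theorem affine_mem_verticalLine {u : F × F} {x : F} :
    affine B u ∈ verticalLine B x ↔ x = u.1 := by
  simp only [affine, verticalLine, point_mem_line, dotProduct, Fin.sum_univ_three, cons_val_zero,
    cons_val_one, cons_val, mul_neg, mul_one, one_mul, mul_zero, add_zero]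
  constructor <;> intro h <;> linear_combination h

theorem direction_injective : Function.Injective (direction B) := by
  intro y y' h
  obtain ⟨a, ha⟩ := (point_eq_point B _ _).mp h
  have h0 := congrFun ha 0
  have h1 := congrFun ha 1
  simp at h0 h1
  rw [h0, one_mul] at h1
  exact h1.symm

theorem direction_ne_vertical (y : F) : direction B y ≠ vertical B := by
  intro h
  obtain ⟨a, ha⟩ := (point_eq_point B _ _).mp h
  have h0 := congrFun ha 0
  simp at h0

theorem affine_injective : Function.Injective (affine B) := by
  intro u u' h
  obtain ⟨a, ha⟩ := (point_eq_point B _ _).mp h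
  have h0 := congrFun ha 0
  have h1 := congrFun ha 1
  have h2 := congrFun ha 2
  simp at h0 h1 h2
  rw [h2, one_mul] at h0 h1
  exact Prod.ext h0.symm h1.symm

theorem slopeLine_injective : Function.Injective2 (slopeLine B) := by
  intro y y' x x' h
  obtain ⟨a, ha⟩ := (line_eq_line B _ _).mp h
  have h0 := congrFun ha 0
  have h1 := congrFun ha 1
  have h2 := congrFun ha 2
  simp at h0 h1 h2
  rw [h1, one_mul] at h0 h2
  exact ⟨h0.symm, h2.symm⟩

theorem verticalLine_injective : Function.Injective (verticalLine B) := by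
  intro x x' h
  obtain ⟨a, ha⟩ := (line_eq_line B _ _).mp h
  have h0 := congrFun ha 0
  have h2 := congrFun ha 2
  simp at h0 h2
  rw [h0, one_mul] at h2
  exact h2.symm

theorem eq_direction_or_vertical {P : Point F} (hP : P ∈ lineAtInfinity B) :
    (∃ y, P = direction B y) ∨ P = vertical B := by
  obtain ⟨c, hc, rfl⟩ := exists_eq_point B P
  rw [lineAtInfinity, point_mem_line] at hP
  have h2 : c 2 = 0 := by simpa [dotProduct, Fin.sum_univ_three] using hP
  by_cases h0 : c 0 = 0
  · right
    rw [vertical, point_eq_point]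
    refine ⟨c 1, ?_⟩
    ext i
    fin_cases i <;> simp [h0, h2]
  · left
    refine ⟨c 1 / c 0, ?_⟩
    rw [direction, point_eq_point]
    refine ⟨c 0, ?_⟩
    ext i
    fin_cases i <;> simp [h0, h2, mul_div_cancel₀]

theorem eq_affine {P : Point F} (hP : P ∉ lineAtInfinity B) : ∃ u, P = affine B u := by
  obtain ⟨c, hc, rfl⟩ := exists_eq_point B P
  rw [lineAtInfinity, point_mem_line] at hP
  have h2 : c 2 ≠ 0 := by simpa [dotProduct, Fin.sum_univ_three] using hP
  refine ⟨(c 0 / c 2, c 1 / c 2), ?_⟩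
  rw [affine, point_eq_point]
  refine ⟨c 2, ?_⟩
  ext i
  fin_cases i <;> simp [h2, mul_div_cancel₀]

theorem eq_slopeLine {r : Line F} (hr : r ≠ lineAtInfinity B) {y : F} (hy : direction B y ∈ r) :
    ∃ x, r = slopeLine B y x := by
  obtain ⟨d, hd, rfl⟩ := exists_eq_line B r
  rw [direction, point_mem_line] at hy
  have h0 : d 0 + y * d 1 = 0 := by simpa [dotProduct, Fin.sum_univ_three] using hy
  have h1 : d 1 ≠ 0 := by
    intro h1
    rw [h1, mul_zero, add_zero] at h0
    refine hr ?_
    rw [lineAtInfinity, line_eq_line]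
    refine ⟨d 2, ?_⟩
    ext i
    fin_cases i <;> simp [h0, h1]
  refine ⟨d 2 / d 1, ?_⟩
  rw [slopeLine, line_eq_line]
  refine ⟨d 1, ?_⟩
  ext i
  fin_cases i
  · simp
    linear_combination -h0
  · simp
  · simp [h1, mul_div_cancel₀]

theorem eq_verticalLine {r : Line F} (hr : r ≠ lineAtInfinity B) (hy : vertical B ∈ r) :
    ∃ x, r = verticalLine B x := by
  obtain ⟨d, hd, rfl⟩ := exists_eq_line B r
  rw [vertical, point_mem_line] at hy
  have h1 : d 1 = 0 := by simpa [dotProduct, Fin.sum_univ_three] using hy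
  have h0 : d 0 ≠ 0 := by
    intro h0
    refine hr ?_
    rw [lineAtInfinity, line_eq_line]
    refine ⟨d 2, ?_⟩
    ext i
    fin_cases i <;> simp [h0, h1]
  refine ⟨- d 2 / d 0, ?_⟩
  rw [verticalLine, line_eq_line]
  refine ⟨- d 0, ?_⟩
  ext i
  fin_cases i
  · simp
  · simp [h1]
  · simp
    field_simp

theorem slopeLine_ne (y x : F) : slopeLine B y x ≠ lineAtInfinity B := by
  intro h
  obtain ⟨a, ha⟩ := (line_eq_line B _ _).mp h
  have h1 := congrFun ha 1
  simp at h1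

theorem verticalLine_ne (x : F) : verticalLine B x ≠ lineAtInfinity B := by
  intro h
  obtain ⟨a, ha⟩ := (line_eq_line B _ _).mp h
  have h0 := congrFun ha 0
  simp at h0

theorem exists_lineAtInfinity_eq (r : Line F) :
    ∃ B : (Matrix (Fin 3) (Fin 3) F)ˣ, lineAtInfinity B = r := by
  have key : ∀ M : Matrix (Fin 3) (Fin 3) F, M.det ≠ 0 → M *ᵥ ![0, 0, 1] = r.rep →
      ∃ B : (Matrix (Fin 3) (Fin 3) F)ˣ, lineAtInfinity B = r := by
    intro M hM hMr
    obtain ⟨A, hA⟩ := (Matrix.isUnit_iff_isUnit_det M).mpr hM.isUnit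
    refine ⟨A⁻¹, ?_⟩
    conv_rhs => rw [← r.mk_rep]
    simp only [lineAtInfinity, line, inv_inv, hA, hMr]
  by_cases h2 : r.rep 2 = 0
  · by_cases h1 : r.rep 1 = 0
    · have h0 : r.rep 0 ≠ 0 := by
        intro h0
        refine r.rep_nonzero ?_
        ext i
        fin_cases i <;> simp [h0, h1, h2]
      refine key !![0, 0, r.rep 0; 1, 0, r.rep 1; 0, 1, r.rep 2] ?_ ?_
      · simpa [det_fin_three] using h0
      · ext i
        fin_cases i <;> simp [mulVec, dotProduct, Fin.sum_univ_three]
    · refine key !![1, 0, r.rep 0; 0, 0, r.rep 1; 0, 1, r.rep 2] ?_ ?_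
      · simpa [det_fin_three] using h1
      · ext i
        fin_cases i <;> simp [mulVec, dotProduct, Fin.sum_univ_three]
  · refine key !![1, 0, r.rep 0; 0, 1, r.rep 1; 0, 0, r.rep 2] ?_ ?_
    · simpa [det_fin_three] using h2
    · ext i
      fin_cases i <;> simp [mulVec, dotProduct, Fin.sum_univ_three]

/-- Every slope can be made infinite. -/
theorem exists_vertical_eq_direction (y : F) :
    ∃ B' : (Matrix (Fin 3) (Fin 3) F)ˣ, lineAtInfinity B' = lineAtInfinity B ∧
      vertical B' = direction B y := by
  set M : Matrix (Fin 3) (Fin 3) F := !![0, 1, 0; 1, y, 0; 0, 0, 1] with hM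
  set N : Matrix (Fin 3) (Fin 3) F := !![-y, 1, 0; 1, 0, 0; 0, 0, 1] with hN
  have hMN : M * N = 1 := by
    ext i j
    fin_cases i <;> fin_cases j <;> simp [hM, hN, mul_apply, Fin.sum_univ_three]
  have hNM : N * M = 1 := by
    ext i j
    fin_cases i <;> fin_cases j <;> simp [hM, hN, mul_apply, Fin.sum_univ_three]
  refine ⟨⟨M, N, hMN, hNM⟩ * B, ?_, ?_⟩
  · simp only [lineAtInfinity, line, _root_.mul_inv_rev, Units.val_mul, Units.inv_mk]
    congr 1
    rw [← mulVec_mulVec]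
    congr 1
    ext i
    fin_cases i <;> simp [hN, mulVec, dotProduct, Fin.sum_univ_three]
  · simp only [vertical, direction, point, Units.val_mul]
    congr 1
    rw [← vecMul_vecMul]
    congr 1
    ext i
    fin_cases i <;> simp [hM, vecMul, dotProduct, Fin.sum_univ_three]

/-- A line with at most `q` points in `S` is the line at infinity of a frame whose vertical
direction is not in `S`. -/
theorem exists_frame [Fintype F] {S : Set (Point F)} {r : Line F}
    (h : (meet S r).ncard ≤ Fintype.card F) :
    ∃ B : (Matrix (Fin 3) (Fin 3) F)ˣ, lineAtInfinity B = r ∧ vertical B ∉ S := by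
  obtain ⟨B, rfl⟩ := exists_lineAtInfinity_eq r
  by_cases hv : vertical B ∈ S
  · by_cases hd : ∀ y, direction B y ∈ S
    · exfalso
      have h1 : insert (vertical B) (Set.range (direction B)) ⊆ meet S (lineAtInfinity B) := by
        rintro P (rfl | ⟨y, rfl⟩)
        · exact ⟨hv, vertical_mem B⟩
        · exact ⟨hd y, direction_mem B y⟩
      have h2 := Set.ncard_le_ncard h1 (Set.toFinite _)
      rw [Set.ncard_insert_of_notMem, ← Set.image_univ,
        Set.ncard_image_of_injective _ (direction_injective B), Set.ncard_univ,
        Nat.card_eq_fintype_card] at h2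
      · omega
      · rintro ⟨y, hy⟩
        exact direction_ne_vertical B y hy
    · push Not at hd
      obtain ⟨y, hy⟩ := hd
      obtain ⟨B', h1, h2⟩ := exists_vertical_eq_direction B y
      exact ⟨B', h1, by rwa [h2]⟩
  · exact ⟨B, rfl, hv⟩

theorem ncard_slopeLine_image (y : F) (T : Finset F) :
    (slopeLine B y '' (T : Set F)).ncard = T.card := by
  rw [Set.ncard_image_of_injective _ fun _ _ h => (slopeLine_injective B h).2,
    Set.ncard_coe_finset]

theorem ncard_verticalLine_image (T : Finset F) :
    (verticalLine B '' (T : Set F)).ncard = T.card := by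
  rw [Set.ncard_image_of_injective _ (verticalLine_injective B), Set.ncard_coe_finset]

end Coordinates

/-! ### Tangents and skew lines as missing values. -/

section PointSet

variable {F : Type*} [Field F] [Fintype F]

variable (B : (Matrix (Fin 3) (Fin 3) F)ˣ) (S : Set (Point F))

open Classical in
/-- The affine points of `S`. -/
noncomputable def affinePart : Finset (F × F) := Finset.univ.filter fun u => affine B u ∈ S

open Classical in
/-- The slopes of the points at infinity of `S`. -/
noncomputable def slopes : Finset F := Finset.univ.filter fun y => direction B y ∈ S

variable {B S}

theorem mem_affinePart {u : F × F} : u ∈ affinePart B S ↔ affine B u ∈ S := by simp [affinePart]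

theorem mem_slopes {y : F} : y ∈ slopes B S ↔ direction B y ∈ S := by simp [slopes]

theorem meet_lineAtInfinity (hv : vertical B ∉ S) :
    meet S (lineAtInfinity B) = direction B '' slopes B S := by
  ext P
  constructor
  · rintro ⟨hS, hP⟩
    rcases eq_direction_or_vertical B hP with ⟨y, rfl⟩ | rfl
    · exact ⟨y, mem_slopes.mpr hS, rfl⟩
    · exact absurd hS hv
  · rintro ⟨y, hy, rfl⟩
    exact ⟨mem_slopes.mp hy, direction_mem B y⟩

theorem ncard_meet_lineAtInfinity (hv : vertical B ∉ S) :
    (meet S (lineAtInfinity B)).ncard = (slopes B S).card := by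
  rw [meet_lineAtInfinity hv, Set.ncard_image_of_injective _ (direction_injective B),
    Set.ncard_coe_finset]

theorem ncard_eq (hv : vertical B ∉ S) :
    S.ncard = (slopes B S).card + (affinePart B S).card := by
  have h : S = meet S (lineAtInfinity B) ∪ affine B '' affinePart B S := by
    ext P
    constructor
    · intro hS
      by_cases hP : P ∈ lineAtInfinity B
      · exact Or.inl ⟨hS, hP⟩
      · obtain ⟨u, rfl⟩ := eq_affine B hP
        exact Or.inr ⟨u, mem_affinePart.mpr hS, rfl⟩
    · rintro (h | ⟨u, hu, rfl⟩)
      · exact h.1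
      · exact mem_affinePart.mp hu
  conv_lhs => rw [h]
  rw [Set.ncard_union_eq ?_ (Set.toFinite _) (Set.toFinite _), ncard_meet_lineAtInfinity hv,
    Set.ncard_image_of_injective _ (affine_injective B), Set.ncard_coe_finset]
  rw [Set.disjoint_left]
  rintro _ h ⟨u, -, rfl⟩
  exact affine_notMem B u h.2

/-- Inclusion, rather than equality, treats tangents (direction in `S`) and skew lines (direction
outside `S`) together. -/
theorem meet_slopeLine_subset {y x : F} :
    meet S (slopeLine B y x) ⊆ {direction B y} ↔ x ∈ missing (affinePart B S) y := by
  simp only [missing, Finset.mem_filter, Finset.mem_univ, true_and]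
  constructor
  · intro h u hu hx
    have h1 := h (show affine B u ∈ _ from ⟨mem_affinePart.mp hu, (affine_mem_slopeLine B).mpr hx⟩)
    refine affine_notMem B u ?_
    rw [Set.mem_singleton_iff.mp h1]
    exact direction_mem B y
  · rintro h P ⟨hS, hP⟩
    by_cases hPi : P ∈ lineAtInfinity B
    · by_contra hne
      exact slopeLine_ne B y x <| ((Configuration.Nondegenerate.eq_or_eq hP
        (direction_mem_slopeLine B y x) hPi (direction_mem B y)).resolve_left hne)
    · obtain ⟨u, rfl⟩ := eq_affine B hPi
      exact absurd ((affine_mem_slopeLine B).mp hP) (h u (mem_affinePart.mpr hS))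

theorem meet_verticalLine_subset {x : F} :
    meet S (verticalLine B x) ⊆ {vertical B} ↔ x ∈ missingAtInfinity (affinePart B S) := by
  simp only [missingAtInfinity, Finset.mem_filter, Finset.mem_univ, true_and]
  constructor
  · intro h u hu hx
    have h1 := h (show affine B u ∈ _ from
      ⟨mem_affinePart.mp hu, (affine_mem_verticalLine B).mpr hx⟩)
    refine affine_notMem B u ?_
    rw [Set.mem_singleton_iff.mp h1]
    exact vertical_mem B
  · rintro h P ⟨hS, hP⟩
    by_cases hPi : P ∈ lineAtInfinity B
    · by_contra hne
      exact verticalLine_ne B x <| ((Configuration.Nondegenerate.eq_or_eq hP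
        (vertical_mem_verticalLine B x) hPi (vertical_mem B)).resolve_left hne)
    · obtain ⟨u, rfl⟩ := eq_affine B hPi
      exact absurd ((affine_mem_verticalLine B).mp hP) (h u (mem_affinePart.mpr hS))

theorem tangentsAt_direction (h1 : (meet S (lineAtInfinity B)).ncard ≠ 1) {y : F}
    (hy : direction B y ∈ S) :
    tangentsAt S (direction B y) = slopeLine B y '' missing (affinePart B S) y := by
  ext r
  constructor
  · intro hr
    have hr' : meet S r = {direction B y} := hr
    have hne : r ≠ lineAtInfinity B := by
      rintro rfl
      rw [hr', Set.ncard_singleton] at h1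
      exact h1 rfl
    have hmem : direction B y ∈ meet S r := by rw [hr']; rfl
    obtain ⟨x, rfl⟩ := eq_slopeLine B hne hmem.2
    exact ⟨x, meet_slopeLine_subset.mp hr'.subset, rfl⟩
  · rintro ⟨x, hx, rfl⟩
    refine (meet_slopeLine_subset.mpr hx).antisymm (Set.singleton_subset_iff.mpr ?_)
    exact ⟨hy, direction_mem_slopeLine B y x⟩

theorem skewLinesThrough_direction (h0 : (meet S (lineAtInfinity B)).ncard ≠ 0) {y : F}
    (hy : direction B y ∉ S) :
    skewLinesThrough S (direction B y) = slopeLine B y '' missing (affinePart B S) y := by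
  ext r
  constructor
  · rintro ⟨hmem, hr⟩
    have hr' : meet S r = ∅ := hr
    have hne : r ≠ lineAtInfinity B := by
      rintro rfl
      rw [hr', Set.ncard_empty] at h0
      exact h0 rfl
    obtain ⟨x, rfl⟩ := eq_slopeLine B hne hmem
    exact ⟨x, meet_slopeLine_subset.mp (by rw [hr']; exact Set.empty_subset _), rfl⟩
  · rintro ⟨x, hx, rfl⟩
    refine ⟨direction_mem_slopeLine B y x, Set.eq_empty_iff_forall_notMem.mpr fun P hP => hy ?_⟩
    rw [← Set.mem_singleton_iff.mp (meet_slopeLine_subset.mpr hx hP)]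
    exact hP.1

theorem skewLinesThrough_vertical (h0 : (meet S (lineAtInfinity B)).ncard ≠ 0)
    (hv : vertical B ∉ S) :
    skewLinesThrough S (vertical B) = verticalLine B '' missingAtInfinity (affinePart B S) := by
  ext r
  constructor
  · rintro ⟨hmem, hr⟩
    have hr' : meet S r = ∅ := hr
    have hne : r ≠ lineAtInfinity B := by
      rintro rfl
      rw [hr', Set.ncard_empty] at h0
      exact h0 rfl
    obtain ⟨x, rfl⟩ := eq_verticalLine B hne hmem
    exact ⟨x, meet_verticalLine_subset.mp (by rw [hr']; exact Set.empty_subset _), rfl⟩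
  · rintro ⟨x, hx, rfl⟩
    refine ⟨vertical_mem_verticalLine B x, Set.eq_empty_iff_forall_notMem.mpr fun P hP => hv ?_⟩
    rw [← Set.mem_singleton_iff.mp (meet_verticalLine_subset.mpr hx hP)]
    exact hP.1

/-- A tangent at a point at infinity of `S`, in coordinates. -/
theorem exists_of_mem_tangentsAlong (hv : vertical B ∉ S)
    (h1 : (meet S (lineAtInfinity B)).ncard ≠ 1) {r : Line F}
    (hr : r ∈ tangentsAlong S (lineAtInfinity B)) :
    ∃ y ∈ slopes B S, ∃ x ∈ missing (affinePart B S) y, r = slopeLine B y x := by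
  obtain ⟨P, hP, hr⟩ := hr
  rw [meet_lineAtInfinity hv] at hP
  obtain ⟨y, hy, rfl⟩ := hP
  rw [tangentsAt_direction h1 (mem_slopes.mp hy)] at hr
  obtain ⟨x, hx, rfl⟩ := hr
  exact ⟨y, hy, x, hx, rfl⟩

/-- The points of `A(n)`, in coordinates. -/
theorem mem_A_iff (h0 : (meet S (lineAtInfinity B)).ncard ≠ 0) {n : ℕ} {P : Point F} :
    P ∈ A S (lineAtInfinity B) n ↔ P ∉ S ∧
      ((∃ y, P = direction B y ∧ (missing (affinePart B S) y).card ≤ n) ∨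
        (P = vertical B ∧ (missingAtInfinity (affinePart B S)).card ≤ n)) := by
  constructor
  · rintro ⟨hP, hS, hn⟩
    refine ⟨hS, ?_⟩
    rcases eq_direction_or_vertical B hP with ⟨y, rfl⟩ | rfl
    · rw [skewLinesThrough_direction h0 hS, ncard_slopeLine_image] at hn
      exact Or.inl ⟨y, rfl, hn⟩
    · rw [skewLinesThrough_vertical h0 hS, ncard_verticalLine_image] at hn
      exact Or.inr ⟨rfl, hn⟩
  · rintro ⟨hS, ⟨y, rfl, hn⟩ | ⟨rfl, hn⟩⟩
    · refine ⟨direction_mem B y, hS, ?_⟩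
      rwa [skewLinesThrough_direction h0 hS, ncard_slopeLine_image]
    · refine ⟨vertical_mem B, hS, ?_⟩
      rwa [skewLinesThrough_vertical h0 hS, ncard_verticalLine_image]

/-- A skew line through a point of `A(n)`, in coordinates. -/
theorem exists_of_mem_skewLinesAlong (h0 : (meet S (lineAtInfinity B)).ncard ≠ 0) {n : ℕ}
    {r : Line F} (hr : r ∈ skewLinesAlong S (lineAtInfinity B) n) :
    (∃ y, (missing (affinePart B S) y).card ≤ n ∧
      ∃ x ∈ missing (affinePart B S) y, r = slopeLine B y x) ∨
    ((missingAtInfinity (affinePart B S)).card ≤ n ∧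
      ∃ x ∈ missingAtInfinity (affinePart B S), r = verticalLine B x) := by
  obtain ⟨P, hP, hr⟩ := hr
  obtain ⟨hS, ⟨y, rfl, hn⟩ | ⟨rfl, hn⟩⟩ := (mem_A_iff h0).mp hP
  · rw [skewLinesThrough_direction h0 hS] at hr
    obtain ⟨x, hx, rfl⟩ := hr
    exact Or.inl ⟨y, hn, x, hx, rfl⟩
  · rw [skewLinesThrough_vertical h0 hS] at hr
    obtain ⟨x, hx, rfl⟩ := hr
    exact Or.inr ⟨hn, x, hx, rfl⟩

/-- Each affine point lies on one line of slope `y`. Applied to a slope of $\ell \cap S$, this gives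
$\varepsilon \ge 0$. -/
theorem card_le_affinePart_add_missing (U : Finset (F × F)) (y : F) :
    Fintype.card F ≤ U.card + (missing U y).card := by
  classical
  have h : (Finset.univ : Finset F) ⊆ U.image (fun u => u.1 * y - u.2) ∪ missing U y := by
    intro x _
    by_cases hx : x ∈ missing U y
    · exact Finset.mem_union_right _ hx
    · simp only [missing, Finset.mem_filter, Finset.mem_univ, true_and, not_forall, not_not] at hx
      obtain ⟨u, hu, rfl⟩ := hx
      exact Finset.mem_union_left _ (Finset.mem_image_of_mem _ hu)
  have h1 := (Finset.card_le_card h).trans (Finset.card_union_le _ _)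
  have h2 := Finset.card_image_le (s := U) (f := fun u => u.1 * y - u.2)
  rw [Finset.card_univ] at h1
  omega

/-- The data of the point set in a suitable frame. -/
theorem exists_frame_data {ℓ : Line F} {k t : ℕ} {ε : ℤ} (hk2 : 2 ≤ k)
    (hkq : k ≤ Fintype.card F) (hℓ : IsSecant S k ℓ)
    (htan : ∀ P ∈ meet S ℓ, (tangentsAt S P).ncard = t)
    (hs : (S.ncard : ℤ) = (k : ℤ) + Fintype.card F - t + ε) :
    ∃ (B : (Matrix (Fin 3) (Fin 3) F)ˣ) (e : ℕ), ℓ = lineAtInfinity B ∧ vertical B ∉ S ∧ ε = e ∧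
      (slopes B S).card = k ∧ (affinePart B S).card + t = Fintype.card F + e ∧
      ∀ y ∈ slopes B S, (missing (affinePart B S) y).card = t := by
  have hk : (meet S ℓ).ncard = k := hℓ
  obtain ⟨B, rfl, hv⟩ := exists_frame (hk.trans_le hkq)
  have hsl : (slopes B S).card = k := by rw [← ncard_meet_lineAtInfinity hv, hk]
  have hmiss : ∀ y ∈ slopes B S, (missing (affinePart B S) y).card = t := by
    intro y hy
    rw [← htan (direction B y) ⟨mem_slopes.mp hy, direction_mem B y⟩,
      tangentsAt_direction (by omega) (mem_slopes.mp hy), ncard_slopeLine_image]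
  obtain ⟨y, hy⟩ : (slopes B S).Nonempty := Finset.card_pos.mp (by omega)
  have h1 := card_le_affinePart_add_missing (affinePart B S) y
  rw [hmiss y hy] at h1
  have h2 := ncard_eq hv
  exact ⟨B, ε.toNat, rfl, hv, by omega, hsl, by omega, hmiss⟩

end PointSet

/-! ### Pencils with carriers off the secant. -/

section Pencils

variable {F : Type*} [Field F] [Fintype F]

variable (B : (Matrix (Fin 3) (Fin 3) F)ˣ) {S : Set (Point F)}

/-- The points with coordinates in `V` may be completed to a set of `n` affine points. -/
theorem exists_affine_carriers {V : Finset (F × F)} {n : ℕ} (hV : V.card ≤ n)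
    (hn : n ≤ Fintype.card F) :
    ∃ C : Finset (Point F), C.card = n ∧ (∀ G ∈ C, G ∉ lineAtInfinity B) ∧
      ∀ u ∈ V, affine B u ∈ C := by
  classical
  obtain ⟨W, hVW, -, hW⟩ := Finset.exists_subsuperset_card_eq (Finset.subset_univ V) hV (by
    rw [Finset.card_univ, Fintype.card_prod]
    exact hn.trans (Nat.le_mul_of_pos_left _ Fintype.card_pos))
  refine ⟨W.image (affine B), ?_, fun G hG => ?_, fun u hu => Finset.mem_image_of_mem _ (hVW hu)⟩
  · rw [Finset.card_image_of_injective _ (affine_injective B), hW]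
  · obtain ⟨u, -, rfl⟩ := Finset.mem_image.mp hG
    exact affine_notMem B u

variable {B}

theorem belongToPencils_of_carriers {V : Finset (F × F)} {C : Finset (Point F)} {t : ℕ}
    (hv : vertical B ∉ S) (h2 : 2 ≤ (meet S (lineAtInfinity B)).ncard)
    (hK : ∀ y ∈ slopes B S, (missing (affinePart B S) y).card = t)
    (hVC : ∀ u ∈ V, affine B u ∈ C)
    (h3 : ∀ y, (missing (affinePart B S) y).card ≤ t + 1 →
      ∀ x ∈ missing (affinePart B S) y, ∃ u ∈ V, x = u.1 * y - u.2)
    (h4 : (missingAtInfinity (affinePart B S)).card ≤ t + 1 →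
      ∀ x ∈ missingAtInfinity (affinePart B S), ∃ u ∈ V, x = u.1) :
    BelongToPencils
      (tangentsAlong S (lineAtInfinity B) ∪ skewLinesAlong S (lineAtInfinity B) (t + 1)) C := by
  rintro r (hr | hr)
  · obtain ⟨y, hy, x, hx, rfl⟩ := exists_of_mem_tangentsAlong hv (by omega) hr
    obtain ⟨u, hu, hux⟩ := h3 y (by rw [hK y hy]; omega) x hx
    exact ⟨_, hVC u hu, (affine_mem_slopeLine B).mpr hux⟩
  · rcases exists_of_mem_skewLinesAlong (by omega) hr with ⟨y, hy, x, hx, rfl⟩ | ⟨hy, x, hx, rfl⟩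
    · obtain ⟨u, hu, hux⟩ := h3 y hy x hx
      exact ⟨_, hVC u hu, (affine_mem_slopeLine B).mpr hux⟩
    · obtain ⟨u, hu, hux⟩ := h4 hy x hx
      exact ⟨_, hVC u hu, (affine_mem_verticalLine B).mpr hux⟩

theorem A_succ_sdiff_eq_empty {t : ℕ} (h0 : (meet S (lineAtInfinity B)).ncard ≠ 0)
    (h3 : ∀ y, (missing (affinePart B S) y).card ≤ t + 1 →
      (missing (affinePart B S) y).card ≤ t)
    (h4 : (missingAtInfinity (affinePart B S)).card ≤ t + 1 →
      (missingAtInfinity (affinePart B S)).card ≤ t) :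
    A S (lineAtInfinity B) (t + 1) \ A S (lineAtInfinity B) t = ∅ := by
  rw [Set.sdiff_eq_empty]
  intro P hP
  rw [mem_A_iff h0] at hP ⊢
  refine ⟨hP.1, hP.2.imp ?_ ?_⟩
  · rintro ⟨y, rfl, hy⟩
    exact ⟨y, rfl, h3 y hy⟩
  · rintro ⟨rfl, hy⟩
    exact ⟨rfl, h4 hy⟩

/-- If `|S| = k + q - t + ε` with `ε` small, then the tangents at the points of a `k`-secant and
the skew lines through its points of small index belong to `t` pencils. -/
theorem exists_pencils {ℓ : Line F} {k t : ℕ} {ε : ℤ} (hk2 : 2 ≤ k)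
    (hkq : k ≤ Fintype.card F) (ht1 : 1 ≤ t) (htq : t + 3 ≤ Fintype.card F)
    (hℓ : IsSecant S k ℓ) (htan : ∀ P ∈ meet S ℓ, (tangentsAt S P).ncard = t)
    (hs : (S.ncard : ℤ) = (k : ℤ) + Fintype.card F - t + ε)
    (hε : (t + 1) * (ε + 1) < (k : ℤ)) (hkt : Fintype.card F * (t - 1) < (k - 1) * t) {n : ℕ}
    (htn : t ≤ n) (hn : n ≤ Fintype.card F) :
    (∃ C : Finset (Point F), C.card = n ∧ (∀ G ∈ C, G ∉ ℓ) ∧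
      BelongToPencils (tangentsAlong S ℓ ∪ skewLinesAlong S ℓ (t + 1)) C) ∧
    A S ℓ (t + 1) \ A S ℓ t = ∅ := by
  obtain ⟨B, e, rfl, hv, rfl, hK, hU, hmiss⟩ := exists_frame_data hk2 hkq hℓ htan hs
  have hk : (meet S (lineAtInfinity B)).ncard = k := hℓ
  subst hK
  obtain ⟨V, hV, h3, h4⟩ := exists_carriers_of_missing ht1 hU hmiss (by exact_mod_cast hε) htq hkt
  -- Fewer than `n` carriers may occur; arbitrary affine points complete them.
  obtain ⟨C, hC, hCℓ, hVC⟩ := exists_affine_carriers B (hV.trans htn) hn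
  refine ⟨⟨C, hC, hCℓ, belongToPencils_of_carriers hv (by omega) hmiss hVC
    (fun y hy => (h3 y hy).2) (fun hy => (h4 hy).2)⟩, A_succ_sdiff_eq_empty (by omega)
    (fun y hy => (h3 y hy).1) (fun hy => (h4 hy).1)⟩

end Pencils

/-! ### Dual conics: arcs or pairs of pencils. -/

section Conic

variable {F : Type*} [Field F]

/-- The linear form on the line coordinates whose zeros are the lines through the point with
coordinates `c`. -/
def pairing (c : Fin 3 → F) : (Fin 3 → F) →ₗ[F] F where
  toFun d := c ⬝ᵥ d
  map_add' := dotProduct_add c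
  map_smul' a d := dotProduct_smul a c d

theorem exists_eq_pairing (g : (Fin 3 → F) →ₗ[F] F) : ∃ c, g = pairing c := by
  refine ⟨fun i => g (Pi.single i 1), LinearMap.pi_ext' fun i => LinearMap.ext_ring ?_⟩
  simp [pairing]

/-- The lines of a conic envelope form a dual arc or belong to two pencils. -/
theorem isDualArc_or_belongToPencils (B : (Matrix (Fin 3) (Fin 3) F)ˣ)
    {φ : QuadraticForm F (Fin 3 → F)} (hφ : φ ≠ 0) {L : Set (Line F)} [Finite F]
    (hL : ∀ r ∈ L, ∃ d hd, r = line B d hd ∧ φ d = 0) :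
    IsDualArc L ∨ ∃ C : Finset (Point F), C.card = 2 ∧ BelongToPencils L C := by
  classical
  by_cases h : IsDualArc L
  · exact Or.inl h
  right
  simp only [IsDualArc, not_forall, not_le] at h
  obtain ⟨G, hG⟩ := h
  obtain ⟨c, hc, rfl⟩ := exists_eq_point B G
  obtain ⟨r₁, ⟨h₁, g₁⟩, r₂, ⟨h₂, g₂⟩, r₃, ⟨h₃, g₃⟩, h₁₂, h₁₃, h₂₃⟩ :=
    (Set.two_lt_ncard (Set.toFinite _)).mp hG
  obtain ⟨d₁, hd₁, rfl, φ₁⟩ := hL r₁ h₁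
  obtain ⟨d₂, hd₂, rfl, φ₂⟩ := hL r₂ h₂
  obtain ⟨d₃, hd₃, rfl, φ₃⟩ := hL r₃ h₃
  have e₁ : pairing c d₁ = 0 := (point_mem_line B hc hd₁).mp g₁
  have e₂ : pairing c d₂ = 0 := (point_mem_line B hc hd₂).mp g₂
  have e₃ : pairing c d₃ = 0 := (point_mem_line B hc hd₃).mp g₃
  have hp : pairing c ≠ 0 := by
    intro h
    refine hc (funext fun i => ?_)
    simpa [pairing] using LinearMap.congr_fun h (Pi.single i 1)
  have hli : LinearIndependent F ![d₁, d₂] := by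
    rw [LinearIndependent.pair_iff' hd₁]
    intro a ha
    exact h₁₂ ((line_eq_line B hd₂ hd₁).mpr ⟨a, ha⟩).symm
  have hspan : Submodule.span F {d₁, d₂} = LinearMap.ker (pairing c) := by
    refine Submodule.eq_of_le_of_finrank_eq ?_ ?_
    · rw [Submodule.span_le]
      rintro d (rfl | rfl)
      · exact e₁
      · exact e₂
    · have h1 := finrank_span_eq_card hli
      have h2 := Module.Dual.finrank_ker_add_one_of_ne_zero (f := pairing c) hp
      rw [Module.finrank_fin_fun] at h2
      rw [range_cons_cons_empty, Fintype.card_fin] at h1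
      rw [h1]
      omega
  have hker : ∀ x, pairing c x = 0 → ∃ a b : F, x = a • d₁ + b • d₂ := by
    intro x hx
    have : x ∈ Submodule.span F {d₁, d₂} := by rw [hspan]; exact hx
    obtain ⟨a, b, hab⟩ := Submodule.mem_span_pair.mp this
    exact ⟨a, b, hab.symm⟩
  obtain ⟨a, b, rfl⟩ := hker d₃ e₃
  have ha : a ≠ 0 := by
    rintro rfl
    exact h₂₃ ((line_eq_line B hd₃ hd₂).mpr ⟨b, by simp⟩).symm
  have hb : b ≠ 0 := by
    rintro rfl
    exact h₁₃ ((line_eq_line B hd₃ hd₁).mpr ⟨a, by simp⟩).symm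
  -- Three concurrent lines are three collinear points of the dual conic, so the dual line of their
  -- common point is a component; the cofactor is the second pencil.
  obtain ⟨g, hg⟩ := QuadraticForm.exists_eq_mul_of_isotropic φ hp hker ha hb φ₁ φ₂ φ₃
  obtain ⟨c', rfl⟩ := exists_eq_pairing g
  have hc' : c' ≠ 0 := by
    rintro rfl
    refine hφ (QuadraticMap.ext fun x => ?_)
    rw [hg]
    simp [pairing]
  obtain ⟨C, hC, hcC, hcC'⟩ : ∃ C : Finset (Point F), C.card = 2 ∧ point B c hc ∈ C ∧
      point B c' hc' ∈ C := by
    -- For a double component an arbitrary second carrier is added.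
    by_cases hcc : point B c hc = point B c' hc'
    · obtain ⟨P, hP⟩ : ∃ P : Point F, P ≠ point B c hc := by
        by_cases hv : vertical B = point B c hc
        · exact ⟨direction B 0, fun h => direction_ne_vertical B 0 (h.trans hv.symm)⟩
        · exact ⟨_, hv⟩
      exact ⟨{P, point B c hc}, Finset.card_pair hP, by simp, by simp [← hcc]⟩
    · exact ⟨{point B c hc, point B c' hc'}, Finset.card_pair hcc, by simp, by simp⟩
  refine ⟨C, hC, fun r hr => ?_⟩
  obtain ⟨d, hd, rfl, hφd⟩ := hL r hr
  rw [hg, mul_eq_zero] at hφd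
  rcases hφd with h | h
  · exact ⟨_, hcC, (point_mem_line B hc hd).mpr h⟩
  · exact ⟨_, hcC', (point_mem_line B hc' hd).mpr h⟩

/-- The quadratic form on the line coordinates given by a polynomial of total degree two. -/
theorem exists_quadraticForm {Q : F[X][X]} (hQ0 : Q ≠ 0) (hQ : TotLE Q 2) :
    ∃ φ : QuadraticForm F (Fin 3 → F), φ ≠ 0 ∧
      (∀ x y, φ ![-y, 1, x] = (Q.eval (C x)).eval y) ∧
      ∀ x, φ ![-1, 0, x] = (atInfinity 2 Q).eval x := by
  set a : ℕ → ℕ → F := fun j i => (Q.coeff j).coeff i with ha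
  let f : Fin 3 → Fin 3 → QuadraticForm F (Fin 3 → F) := fun i j =>
    QuadraticMap.linMulLin (LinearMap.proj i) (LinearMap.proj j)
  have hf : ∀ i j d, f i j d = d i * d j := fun i j d => rfl
  -- The homogenization of `Q` under $X = d_2/d_1$, $Y = -d_0/d_1$, matching the coordinates $[-y :
  -- 1 : x]$ of `slopeLine`; $d_1 = 0$ gives the vertical lines.
  set φ : QuadraticForm F (Fin 3 → F) := a 0 0 • f 1 1 - a 0 1 • f 0 1 + a 0 2 • f 0 0 +
    a 1 0 • f 2 1 - a 1 1 • f 0 2 + a 2 0 • f 2 2 with hφ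
  have hφd : ∀ d, φ d = a 0 0 * (d 1 * d 1) - a 0 1 * (d 0 * d 1) + a 0 2 * (d 0 * d 0) +
      a 1 0 * (d 2 * d 1) - a 1 1 * (d 0 * d 2) + a 2 0 * (d 2 * d 2) := by
    intro d
    simp [hφ, hf]
  have hdeg : ∀ j, (Q.coeff j).natDegree ≤ 2 - j := hQ.natDegree_coeff_le (d := 2)
  have hQn : Q.natDegree ≤ 2 :=
    natDegree_le_iff_coeff_eq_zero.mpr fun j hj => hQ.coeff_eq_zero (by exact_mod_cast hj)
  refine ⟨φ, fun h => hQ0 ?_, fun x y => ?_, fun x => ?_⟩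
  · have h' : ∀ d, φ d = 0 := fun d => by rw [h]; rfl
    have k1 : a 0 0 = 0 := by simpa [hφd] using h' ![0, 1, 0]
    have k2 : a 0 2 = 0 := by simpa [hφd] using h' ![1, 0, 0]
    have k3 : a 2 0 = 0 := by simpa [hφd] using h' ![0, 0, 1]
    have k4 : a 0 1 = 0 := by simpa [hφd, k1, k2] using h' ![1, 1, 0]
    have k5 : a 1 0 = 0 := by simpa [hφd, k1, k3] using h' ![0, 1, 1]
    have k6 : a 1 1 = 0 := by simpa [hφd, k2, k3] using h' ![1, 0, 1]
    ext j i
    rw [coeff_zero, coeff_zero]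
    by_cases hji : i + j ≤ 2
    · obtain ⟨hi, hj⟩ : i ≤ 2 ∧ j ≤ 2 := by omega
      change a j i = 0
      interval_cases i <;> interval_cases j <;> first | assumption | omega
    · exact hQ j i (by omega)
  · rw [hφd, eval_eq_sum_range' (p := Q) (n := 3) (by omega), Finset.sum_range_succ, Finset.sum_range_succ,
      Finset.sum_range_one, eval_add, eval_add, eval_mul, eval_mul, eval_mul,
      eval_eq_sum_range' (p := Q.coeff 0) (n := 3) (by have := hdeg 0; omega),
      eval_eq_sum_range' (p := Q.coeff 1) (n := 2) (by have := hdeg 1; omega),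
      eval_eq_sum_range' (p := Q.coeff 2) (n := 1) (by have := hdeg 2; omega)]
    simp [Finset.sum_range_succ, ha]
    ring
  · rw [hφd, atInfinity, eval_finsetSum]
    simp only [Finset.sum_range_succ, Finset.sum_range_zero, eval_mul, eval_C, eval_pow, eval_X,
      cons_val_zero, cons_val_one, cons_val, ha]
    ring

end Conic

/-! ### One tangent at each point: two pencils or a dual arc. -/

section TangentEnvelope

variable {F : Type*} [Field F] [Fintype F] {S : Set (Point F)}

theorem ncard_tangentsAlong {B : (Matrix (Fin 3) (Fin 3) F)ˣ} (hv : vertical B ∉ S)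
    (h1 : (meet S (lineAtInfinity B)).ncard ≠ 1) {t : ℕ}
    (hK : ∀ y ∈ slopes B S, (missing (affinePart B S) y).card = t) :
    (tangentsAlong S (lineAtInfinity B)).ncard = (slopes B S).card * t := by
  have h : tangentsAlong S (lineAtInfinity B) = (fun p : (_ : F) × F => slopeLine B p.1 p.2) ''
      ((slopes B S).sigma fun y => missing (affinePart B S) y : Finset ((_ : F) × F)) := by
    ext r
    constructor
    · intro hr
      obtain ⟨y, hy, x, hx, rfl⟩ := exists_of_mem_tangentsAlong hv h1 hr
      exact ⟨⟨y, x⟩, Finset.mem_coe.mpr (Finset.mem_sigma.mpr ⟨hy, hx⟩), rfl⟩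
    · rintro ⟨⟨y, x⟩, hp, rfl⟩
      obtain ⟨hy, hx⟩ := Finset.mem_sigma.mp (Finset.mem_coe.mp hp)
      refine ⟨direction B y, ⟨mem_slopes.mp hy, direction_mem B y⟩, ?_⟩
      rw [tangentsAt_direction h1 (mem_slopes.mp hy)]
      exact ⟨x, hx, rfl⟩
  rw [h, Set.ncard_image_of_injective, Set.ncard_coe_finset, Finset.card_sigma,
    Finset.sum_congr rfl hK, Finset.sum_const, smul_eq_mul]
  rintro ⟨y, x⟩ ⟨y', x'⟩ hp
  obtain ⟨rfl, rfl⟩ := slopeLine_injective B hp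
  rfl

/-- If there is one tangent at each point of a `k`-secant and `|S| = k + q - 1 + ε` with `ε` small,
then these tangents belong to two pencils or form a dual arc. -/
theorem exists_two_pencils_or_isDualKArc {ℓ : Line F} {k : ℕ} {ε : ℤ} (hk2 : 2 ≤ k)
    (hkq : k ≤ Fintype.card F) (hq : 4 ≤ Fintype.card F)
    (hℓ : IsSecant S k ℓ) (htan : ∀ P ∈ meet S ℓ, (tangentsAt S P).ncard = 1)
    (hs : (S.ncard : ℤ) = (k : ℤ) + Fintype.card F - 1 + ε) (hε : 3 * (ε + 2) < 2 * (k : ℤ)) :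
    (∃ C : Finset (Point F), C.card = 2 ∧ BelongToPencils (tangentsAlong S ℓ) C ∧
      (k < Fintype.card F → BelongToPencils (skewLinesAlong S ℓ 2) C)) ∨
    (IsDualKArc k (tangentsAlong S ℓ) ∧
      (k < Fintype.card F → IsDualArc (tangentsAlong S ℓ ∪ skewLinesAlong S ℓ 2))) := by
  obtain ⟨B, e, rfl, hv, rfl, hK, hU, hmiss⟩ :=
    exists_frame_data hk2 hkq hℓ htan (by push_cast; exact hs)
  have hk : (meet S (lineAtInfinity B)).ncard = k := hℓ
  subst hK
  have hcard := ncard_tangentsAlong hv (by omega) hmiss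
  rw [mul_one] at hcard
  obtain ⟨Q, hQ0, hQ, h1, h2⟩ := exists_conic_envelope hU hmiss (by exact_mod_cast hε) hq
  obtain ⟨φ, hφ, hφ1, hφ2⟩ := exists_quadraticForm hQ0 hQ
  have htanφ : ∀ r ∈ tangentsAlong S (lineAtInfinity B),
      ∃ d hd, r = line B d hd ∧ φ d = 0 := by
    intro r hr
    obtain ⟨y, hy, x, hx, rfl⟩ := exists_of_mem_tangentsAlong hv (by omega) hr
    exact ⟨_, _, rfl, by rw [hφ1, h1 y (by rw [hmiss y hy]; omega) x hx]⟩
  -- Vertical skew lines are known to lie on the conic only for $k < q$; otherwise just the tangents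
  -- are used.
  by_cases hkq' : (slopes B S).card < Fintype.card F
  · have hallφ : ∀ r ∈ tangentsAlong S (lineAtInfinity B) ∪ skewLinesAlong S (lineAtInfinity B) 2,
        ∃ d hd, r = line B d hd ∧ φ d = 0 := by
      rintro r (hr | hr)
      · exact htanφ r hr
      · rcases exists_of_mem_skewLinesAlong (by omega) hr with
          ⟨y, hy, x, hx, rfl⟩ | ⟨hy, x, hx, rfl⟩
        · exact ⟨_, _, rfl, by rw [hφ1, h1 y hy x hx]⟩
        · exact ⟨_, _, rfl, by rw [hφ2, h2 hkq' hy x hx]⟩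
    rcases isDualArc_or_belongToPencils B hφ hallφ with h | ⟨C, hC, h⟩
    · refine Or.inr ⟨⟨hcard, fun G => ?_⟩, fun _ => h⟩
      refine (Set.ncard_le_ncard ?_ (Set.toFinite _)).trans (h G)
      exact Set.inter_subset_inter_left _ Set.subset_union_left
    · exact Or.inl ⟨C, hC, fun r hr => h r (Or.inl hr), fun _ r hr => h r (Or.inr hr)⟩
  · rcases isDualArc_or_belongToPencils B hφ htanφ with h | ⟨C, hC, h⟩
    · exact Or.inr ⟨⟨hcard, h⟩, fun h' => absurd h' hkq'⟩
    · exact Or.inl ⟨C, hC, h, fun h' => absurd h' hkq'⟩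

end TangentEnvelope

end PG2

/-! ### Derivation of the four claims. -/

theorem lemma3p4 {F : Type*} [Field F] [Fintype F] (q : ℕ) (hq : Fintype.card F = q)
    (S : Set (PG2.Point F)) (ℓ : PG2.Line F) (k t : ℕ) (ε : ℤ)
    (hk2 : 2 ≤ k) (hkq : k ≤ q) (ht1 : 1 ≤ t) (htq : t + 3 ≤ q)
    (hℓ : PG2.IsSecant S k ℓ)
    (htan : ∀ P ∈ PG2.meet S ℓ, (PG2.tangentsAt S P).ncard = t)
    (hs : (S.ncard : ℤ) = (k : ℤ) + q - t + ε) :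
    (t = 1 →
      ((ε : ℝ) < (k : ℝ) / 2 - 1 →
        (∃ G : PG2.Point F,
          PG2.tangentsAlong S ℓ ∪ PG2.skewLinesAlong S ℓ 2 ⊆ PG2.pencil G) ∧
        PG2.A S ℓ 2 \ PG2.A S ℓ 1 = ∅) ∧
      ((ε : ℝ) < 2 * (k : ℝ) / 3 - 2 →
        (∃ C : Finset (PG2.Point F), C.card = 2 ∧
          PG2.BelongToPencils (PG2.tangentsAlong S ℓ) C ∧
          (k < q → PG2.BelongToPencils (PG2.skewLinesAlong S ℓ 2) C)) ∨
        (PG2.IsDualKArc k (PG2.tangentsAlong S ℓ) ∧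
          (k < q →
            PG2.IsDualArc (PG2.tangentsAlong S ℓ ∪ PG2.skewLinesAlong S ℓ 2))))) ∧
    (2 ≤ t → (k : ℝ) > (q : ℝ) - (q : ℝ) / (t : ℝ) + 1 →
      ((ε : ℝ) < (k : ℝ) / ((t : ℝ) + 1) - (t : ℝ) / 2 →
        (∃ C : Finset (PG2.Point F), C.card = t ∧ (∀ G ∈ C, G ∉ ℓ) ∧
          PG2.BelongToPencils
            (PG2.tangentsAlong S ℓ ∪ PG2.skewLinesAlong S ℓ (t + 1)) C) ∧
        PG2.A S ℓ (t + 1) \ PG2.A S ℓ t = ∅) ∧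
      ((ε : ℝ) < (k : ℝ) / ((t : ℝ) + 1) - 1 → (t : ℝ) ≤ Real.sqrt (q : ℝ) →
        ∃ C : Finset (PG2.Point F), C.card = t + 1 ∧ (∀ G ∈ C, G ∉ ℓ) ∧
          PG2.BelongToPencils (PG2.tangentsAlong S ℓ) C ∧
          (k < q → PG2.BelongToPencils (PG2.skewLinesAlong S ℓ (t + 1)) C))) := by
  subst hq
  have ht0 : (0 : ℝ) < (t : ℝ) + 1 := by positivity
  -- This integer inequality serves claims 1, 3 and 4; in claim 3 it applies because $t/2 \ge 1$.
  have hε' : (ε : ℝ) < (k : ℝ) / ((t : ℝ) + 1) - 1 → ((t : ℤ) + 1) * (ε + 1) < k := by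
    intro h
    rw [lt_sub_iff_add_lt, lt_div_iff₀ ht0] at h
    have : ((ε + 1) * ((t : ℤ) + 1) : ℤ) < k := by exact_mod_cast h
    linarith
  refine ⟨?_, fun ht2 hk => ?_⟩
  · rintro rfl
    refine ⟨fun hε => ?_, fun hε => ?_⟩
    · obtain ⟨⟨C, hC, -, h⟩, hA⟩ := PG2.exists_pencils (n := 1) hk2 hkq ht1 htq hℓ htan hs
        (hε' (by norm_num at hε ⊢; linarith)) (by omega) le_rfl (by omega)
      obtain ⟨G, rfl⟩ := Finset.card_eq_one.mp hC
      refine ⟨⟨G, fun r hr => ?_⟩, hA⟩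
      obtain ⟨G', hG', hr'⟩ := h r hr
      rwa [Finset.mem_singleton.mp hG'] at hr'
    · refine PG2.exists_two_pencils_or_isDualKArc hk2 hkq (by omega) hℓ htan
        (by exact_mod_cast hs) ?_
      have h : (3 : ℝ) * (ε + 2) < 2 * k := by linarith
      exact_mod_cast h
  · have hkt : Fintype.card F * (t - 1) < (k - 1) * t := by
      have htpos : (0 : ℝ) < t := by positivity
      have h1 : ((Fintype.card F : ℝ) - Fintype.card F / t + 1) * t < k * t :=
        mul_lt_mul_of_pos_right hk htpos
      have h2 : (Fintype.card F : ℝ) / t * t = Fintype.card F := div_mul_cancel₀ _ htpos.ne'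
      have h3 : (Fintype.card F : ℝ) * (t - 1) < (k - 1) * t := by nlinarith
      have h4 : (((Fintype.card F * (t - 1) : ℕ)) : ℝ) < (((k - 1) * t : ℕ) : ℝ) := by
        push_cast [Nat.cast_sub ht1, Nat.cast_sub (show 1 ≤ k by omega)]
        exact h3
      exact_mod_cast h4
    refine ⟨fun hε => ?_, fun hε _ => ?_⟩
    · have ht2' : (2 : ℝ) ≤ t := by exact_mod_cast ht2
      exact PG2.exists_pencils hk2 hkq ht1 htq hℓ htan hs (hε' (by linarith)) hkt le_rfl (by omega)
    -- The lines already belong to $t$ pencils; taking `n := t + 1` pads the set of carriers.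
    · obtain ⟨⟨C, hC, hCℓ, h⟩, -⟩ := PG2.exists_pencils (n := t + 1) hk2 hkq ht1 htq hℓ htan hs
        (hε' hε) hkt (by omega) (by omega)
      exact ⟨C, hC, hCℓ, fun r hr => h r (Or.inl hr), fun _ r hr => h r (Or.inr hr)⟩
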